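/- Let $\mathbb H^3$ be the space of positive definite Hermitian $2\times2$ complex matrices of determinant $1$, with the hyperbolic metric $\cosh d(P,Q)=\tfrac12\operatorname{tr}(P^{-1}Q)$, and let $O$ be the identity matrix. The group $PSL_2(\mathbb C)$ acts on $\mathbb H^3$ by $A(P)=APA^*$. The hyperbolic amoeba of $V\subset PSL_2(\mathbb C)$ is $\varkappa(V)\subset\mathbb H^3$, where $\varkappa(A)=A(O)=AA^*$. A surface of degree $d$ in $PSL_2(\mathbb C)=\mathbb{CP}^3\setminus\{\det=0\}$ is a non-empty zero set in $PSL_2(\mathbb C)$ of a non-zero homogeneous polynomial of degree $d$ in the four matrix entries. For sets $X_i\subset\mathbb H^3$ and scales $h_i\to+\infty$, the tropical limit of $(X_i)$ is the set $L\subset\mathbb H^3$ to which the contracted sets $\{P^{1/h_i}: P\in X_i\}$ converge in the Hausdorff sense on compact sets (i.e. both the upper and the lower Kuratowski limit equal $L$). Claim 1. (i) Let $F$ be a homogeneous polynomial of degree $d$ in the four matrix entries whose coefficients are real-power series $\sum_\lambda a_\lambda t^{\lambda}$, with $a_\lambda\in\mathbb C$ and exponents forming a reversely well-ordered set of reals,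 absolutely convergent for all large real $t$. Suppose that for all large $t$ the specialization $F_t$ is non-zero and has a non-empty zero set $V_t$ in $PSL_2(\mathbb C)$, so that $(V_t)$ is a family of surfaces. Then the tropical limit of the hyperbolic amoebas $\varkappa(V_t)$, as $t\to+\infty$ with scale $\log t$, exists and equals $\{P\in\mathbb H^3: d(O,P)\ge r\}$ for some real $r\ge0$, the complement of an open ball centred at $O$ (the ball is empty if $r=0$). (ii) More generally, let $V_i$ be any family of surfaces of the same degree $d$ in $PSL_2(\mathbb C)$, indexed by a set with a proper filter (for example a sequence), and let $h_i\to+\infty$ be any scales along it. If the hyperbolic amoebas $\varkappa(V_i)$ have a non-empty tropical limit $L$, then $L=\{P\in\mathbb H^3: d(O,P)\ge r\}$ for some real $r\ge0$. -/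

import Mathlib

open Filter Topology
open scoped Matrix MatrixGroups ComplexOrder

noncomputable section

/-! ### Hyperbolic 3-space and the action of `PSL(2, ℂ)` -/

/-- Hyperbolic 3-space: positive definite Hermitian `2 × 2` matrices of determinant `1`
(with the topology of the space of matrices). -/
abbrev Hyp3 : Type := {P : Matrix (Fin 2) (Fin 2) ℂ // P.PosDef ∧ P.det = 1}

namespace Hyp3

/-- The base point, the identity matrix. -/
def base : Hyp3 := ⟨1, Matrix.PosDef.one, Matrix.det_one⟩

/-- The hyperbolic distance on the hyperboloid of positive definite Hermitian matrices of
determinant `1`: `cosh d(P, Q) = tr (P⁻¹ Q) / 2`, which is the Lorentzian product of `P` and `Q`.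
In particular `d(1, P)` is `|log μ|` for any eigenvalue `μ` of `P`. -/
def hdist (P Q : Hyp3) : ℝ := Real.arcosh ((P.1⁻¹ * Q.1).trace.re / 2)

/-- The open ball of centre `P` and radius `r` (empty if `r ≤ 0`). -/
def openBall (P : Hyp3) (r : ℝ) : Set Hyp3 := {Q | hdist P Q < r}

/-- The real power `P ^ h`: same eigenvectors, eigenvalues raised to the power `h`.
It is the homothety with factor `|h|` (preserving rays for `0 ≤ h`) centred at the base point. -/
def power (h : ℝ) (P : Hyp3) : Hyp3 :=
  ⟨P.2.1.isHermitian.cfc (fun x => x ^ h), by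
    have hpos := P.2.1.eigenvalues_pos
    have hdet := P.2.2.symm.trans P.2.1.isHermitian.det_eq_prod_eigenvalues
    have hprod : (P.2.1.isHermitian.eigenvalues 0) * (P.2.1.isHermitian.eigenvalues 1) = 1 := by
      have := hdet.symm
      rw [Fin.prod_univ_two] at this
      exact (RCLike.ofReal_inj (K := ℂ)).1 (by rw [RCLike.ofReal_mul, RCLike.ofReal_one, this])
    rw [Matrix.IsHermitian.cfc, Unitary.conjStarAlgAut_apply]
    constructor
    · have hd : (Matrix.diagonal (RCLike.ofReal ∘ (fun x : ℝ => x ^ h) ∘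
          P.2.1.isHermitian.eigenvalues) : Matrix (Fin 2) (Fin 2) ℂ).PosDef := by
        rw [Matrix.posDef_diagonal_iff]
        intro i
        have : (0 : ℝ) < (P.2.1.isHermitian.eigenvalues i) ^ h := Real.rpow_pos_of_pos (hpos i) h
        simpa using this
      refine (Matrix.IsUnit.posDef_star_right_conjugate_iff ?_).2 hd
      exact (Unitary.toUnits P.2.1.isHermitian.eigenvectorUnitary).isUnit
    · rw [Matrix.det_mul_right_comm, Unitary.mul_star_self_of_mem
        P.2.1.isHermitian.eigenvectorUnitary.2, one_mul, Matrix.det_diagonal, Fin.prod_univ_two]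
      simp only [Function.comp_apply]
      rw [← RCLike.ofReal_mul, ← Real.mul_rpow (hpos 0).le (hpos 1).le, hprod, Real.one_rpow]
      simp⟩

/-- The isometric action `A(P) = A P Aᴴ` of a matrix of determinant `1`. -/
def slAct (A : SL(2, ℂ)) (P : Hyp3) : Hyp3 :=
  ⟨A.1 * P.1 * A.1ᴴ, P.2.1.mul_mul_conjTranspose_same (by
      refine Matrix.vecMul_injective_of_isUnit ?_
      rw [Matrix.isUnit_iff_isUnit_det, A.2]
      exact isUnit_one), by
    rw [Matrix.det_mul, Matrix.det_mul, Matrix.det_conjTranspose, A.2, P.2.2]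
    simp⟩

theorem slAct_mul_center (A Z : SL(2, ℂ)) (hZ : Z ∈ Subgroup.center SL(2, ℂ)) (P : Hyp3) :
    slAct (A * Z) P = slAct A P := by
  obtain ⟨z, hz, hzZ⟩ := Matrix.SpecialLinearGroup.mem_center_iff.1 hZ
  have hz1 : ‖z‖ = 1 := by
    have h2 : z ^ 2 = 1 := by simpa using hz
    have h3 : ‖z‖ ^ 2 = 1 := by rw [← norm_pow, h2, norm_one]
    exact (pow_eq_one_iff_of_nonneg (norm_nonneg z) two_ne_zero).1 h3
  have hzz : (starRingEnd ℂ) z * z = 1 := by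
    rw [Complex.conj_mul', hz1]
    simp
  apply Subtype.ext
  simp only [slAct, Matrix.SpecialLinearGroup.coe_mul, ← hzZ]
  rw [Matrix.scalar_apply, ← Matrix.smul_one_eq_diagonal]
  simp [smul_smul, hzz]

/-- The action of `PSL(2, ℂ)` on hyperbolic 3-space. -/
def act (g : PSL(2, ℂ)) (P : Hyp3) : Hyp3 :=
  Quotient.liftOn' g (fun A => slAct A P) (by
    intro A B hAB
    have h := QuotientGroup.leftRel_apply.1 hAB
    have := slAct_mul_center A (A⁻¹ * B) h P
    rw [mul_inv_cancel_left] at this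
    exact this.symm)

end Hyp3

/-- The hyperbolic amoeba map `ϰ(A) = A(O) = A Aᴴ`. -/
def amoebaMap (g : PSL(2, ℂ)) : Hyp3 := Hyp3.act g Hyp3.base

/-- The hyperbolic amoeba of a subset of `PSL(2, ℂ)`. -/
def hypAmoeba (V : Set PSL(2, ℂ)) : Set Hyp3 := amoebaMap '' V

/-! ### Surfaces and families of surfaces -/

/-- The zero locus in `PSL(2, ℂ)` of a polynomial `f` in the four matrix entries.
For homogeneous `f` the choice of the lift `A` is irrelevant, and the locus is the projective
hypersurface `f = 0` in `ℂP³` without the quadric `det = 0`. -/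
def zeroLocus (f : MvPolynomial (Fin 2 × Fin 2) ℂ) : Set PSL(2, ℂ) :=
  {g | ∃ A : SL(2, ℂ), (QuotientGroup.mk A : PSL(2, ℂ)) = g ∧
    MvPolynomial.eval (fun ij => A.1 ij.1 ij.2) f = 0}

/-- `V` is the surface in `PSL(2, ℂ)` cut out by the homogeneous polynomial `f` of degree `d`. -/
def IsSurfaceOf (d : ℕ) (f : MvPolynomial (Fin 2 × Fin 2) ℂ) (V : Set PSL(2, ℂ)) : Prop :=
  f ≠ 0 ∧ f.IsHomogeneous d ∧ V = zeroLocus f ∧ V.Nonempty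

/-- A real-power series `∑ aₗ t ^ (-l)` in the large variable `t` is an element of the Hahn series
field in `t⁻¹`; it is convergent if it converges absolutely for all large real `t`. -/
def SeriesConverges (x : HahnSeries ℝ ℂ) : Prop :=
  ∀ᶠ t : ℝ in atTop, Summable fun l : ℝ => x.coeff l * ((t ^ (-l) : ℝ) : ℂ)

/-- The sum at `t` of a real-power series. -/
def seriesEval (x : HahnSeries ℝ ℂ) (t : ℝ) : ℂ :=
  ∑' l : ℝ, x.coeff l * ((t ^ (-l) : ℝ) : ℂ)

/-- The complex polynomial obtained by evaluating all coefficients at `t`. -/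
def evalCoeffs {σ : Type*} (F : MvPolynomial σ (HahnSeries ℝ ℂ)) (t : ℝ) : MvPolynomial σ ℂ :=
  ∑ m ∈ F.support, MvPolynomial.monomial m (seriesEval (F.coeff m) t)

/-- `V t`, for large real `t`, is a family of surfaces of degree `d` in `PSL(2, ℂ)` given by one
homogeneous equation over the field of real-power series in `t`, with convergent coefficients. -/
def IsSurfaceFamily (d : ℕ) (V : ℝ → Set PSL(2, ℂ)) : Prop :=
  ∃ F : MvPolynomial (Fin 2 × Fin 2) (HahnSeries ℝ ℂ),
    F.IsHomogeneous d ∧ (∀ m, SeriesConverges (F.coeff m)) ∧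
      ∀ᶠ t in atTop, IsSurfaceOf d (evalCoeffs F t) (V t)

/-! ### Tropical limits -/

/-- `L` is the tropical limit along `l` of the sets `X i` in hyperbolic space, at scale `h i`
(tending to infinity): after contraction to the base point with factor `1 / h i`, the sets converge
to `L`, that is, `L` contains the upper limit and is contained in the lower limit
of the rescaled sets (Hausdorff convergence on compact sets). -/
def IsTropicalLimit {ι : Type*} (l : Filter ι) (h : ι → ℝ) (X : ι → Set Hyp3) (L : Set Hyp3) :
    Prop :=
  (∀ P, (∀ U ∈ 𝓝 P, ∃ᶠ i in l, (Hyp3.power (1 / h i) '' X i ∩ U).Nonempty) → P ∈ L) ∧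
    ∀ P ∈ L, ∀ U ∈ 𝓝 P, ∀ᶠ i in l, (Hyp3.power (1 / h i) '' X i ∩ U).Nonempty

end

/-!
The argument compares the size of a form with that of its weight parts under a maximal torus.

Write a point of hyperbolic space in polar coordinates as `P = U diag(e^s, e^(-s)) Uᴴ` with `U` in
`SU(2)` and `|s| = d(1, P)`. The fibre of the amoeba map over `P` is `U diag(e^(s/2), e^(-s/2))
SU(2)`, so `P` lies in the amoeba of a form `f` of degree `d` if and only if some polynomial `y ↦
f (U diag(y, 1) W) = ∑ G_j(U, W) y^j` with `W` in `SU(2)` vanishes at `y = e^s`. Let `C_j` be the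
size of `G_j` (`weightNorm`). The Weyl group exchanges `j` and `d - j`, and the weight zero part
is the one with `2 j = d`. It dominates up to distance `r` (`CentralDominance`) if `d = 2 n` and
`C_j e^(r (j - n)) ≤ C_n` for all `j > n`. Seen from a large scale, the amoeba fills the
complement of the ball whose radius is the largest such `r`, for the following reasons.

* Inside the ball, up to a bounded distance from its boundary, there are no points of the amoeba
  (`Hyp3.lt_hdist_of_mem_hypAmoeba`). When the zero weight dominates, `f` is nearly equal to `G_n`
  on every coset `U T W` of the maximal torus `T`. Two points of `SU(2)` are joined by three such
  cosets, so `f` is nearly constant on `SU(2)`. Thus `G_n` is bounded below everywhere, and the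
  other weights cannot cancel it inside the ball.

* Outside the ball there are points of the amoeba near every direction
  (`Hyp3.exists_polar_mem_hypAmoeba`). If `f` has no zero on a fibre, then its winding number
  along every circle `U diag(e^(s/2), e^(-s/2)) T W` vanishes, because the circle bounds a disc in
  the fibre; so no weight other than zero can dominate there (`Hyp3.two_mul_eq_of_dominant`). For
  generic `U`, `W`, all `G_j(U, W)` are comparable with `C_j`, uniformly in `f`
  (`exists_pos_forall_mul_weightNorm_le`, by compactness), and on every interval of sufficient
  length there is `s` at which a single `C_j e^(s j)` dominates (`exists_dominant_exponent`).
  Outside the ball this index cannot be the central one.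

After rescaling, the bounded errors disappear, and the amoebas converge to the complement of a
ball as soon as it is eventually decided, at almost every rescaled distance, whether the zero
weight dominates (`exists_isTropicalLimit`). Along an ultrafilter everything is decided, and
limits are unique; this gives the case of arbitrary families. For coefficients in convergent
real-power series each `C_j` is asymptotic to a multiple of a real power of `t`, and comparison of
the exponents decides the dominance.
-/

noncomputable section

/-! ### Polar coordinates on hyperbolic space -/

/-- The compact group `SU(2)`, the stabilizer of the base point. -/
abbrev SU2 : Type := Matrix.specialUnitaryGroup (Fin 2) ℂ

namespace SU2

theorem det_eq_one (U : SU2) : (U : Matrix (Fin 2) (Fin 2) ℂ).det = 1 :=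
  (Matrix.mem_specialUnitaryGroup_iff.1 U.2).2

theorem mul_star_eq_one (U : SU2) :
    (U : Matrix (Fin 2) (Fin 2) ℂ) * (U : Matrix (Fin 2) (Fin 2) ℂ)ᴴ = 1 :=
  Matrix.mem_unitaryGroup_iff.1 (Matrix.mem_specialUnitaryGroup_iff.1 U.2).1

theorem star_mul_eq_one (U : SU2) :
    (U : Matrix (Fin 2) (Fin 2) ℂ)ᴴ * (U : Matrix (Fin 2) (Fin 2) ℂ) = 1 :=
  Matrix.mem_unitaryGroup_iff'.1 (Matrix.mem_specialUnitaryGroup_iff.1 U.2).1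

/-- The inclusion of `SU(2)` in `SL(2, ℂ)`. -/
def toSL (U : SU2) : SL(2, ℂ) := ⟨U, U.det_eq_one⟩

theorem coe_toSL (U : SU2) : (U.toSL : Matrix (Fin 2) (Fin 2) ℂ) = U := rfl

/-- The unit quaternion `a + b j`, as a matrix in `SU(2)`. -/
def ofPair (a b : ℂ) (h : ‖a‖ ^ 2 + ‖b‖ ^ 2 = 1) : SU2 :=
  ⟨!![a, b; -(starRingEnd ℂ) b, (starRingEnd ℂ) a], by
    have h' : a * (starRingEnd ℂ) a + b * (starRingEnd ℂ) b = 1 := by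
      rw [Complex.mul_conj', Complex.mul_conj']
      exact_mod_cast h
    rw [Matrix.mem_specialUnitaryGroup_iff, Matrix.mem_unitaryGroup_iff]
    constructor
    · rw [Matrix.star_eq_conjTranspose]
      ext i j
      fin_cases i <;> fin_cases j <;> simp [Matrix.mul_apply, Fin.sum_univ_two]
      · exact h'
      · ring
      · ring
      · linear_combination h'
    · rw [Matrix.det_fin_two]
      simp
      exact h'⟩

@[simp] theorem coe_ofPair (a b : ℂ) (h : ‖a‖ ^ 2 + ‖b‖ ^ 2 = 1) :
    (ofPair a b h : Matrix (Fin 2) (Fin 2) ℂ)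
      = !![a, b; -(starRingEnd ℂ) b, (starRingEnd ℂ) a] := rfl

/-- Every element of `SU(2)` is a unit quaternion. -/
theorem exists_eq_ofPair (U : SU2) : ∃ a b : ℂ, ∃ h : ‖a‖ ^ 2 + ‖b‖ ^ 2 = 1, U = ofPair a b h := by
  have h1 : (U : Matrix (Fin 2) (Fin 2) ℂ)ᴴ = (U : Matrix (Fin 2) (Fin 2) ℂ).adjugate := by
    calc (U : Matrix (Fin 2) (Fin 2) ℂ)ᴴ
        = (U : Matrix (Fin 2) (Fin 2) ℂ)ᴴ * (U.1 * (U : Matrix (Fin 2) (Fin 2) ℂ).adjugate) := by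
          rw [Matrix.mul_adjugate, U.det_eq_one, one_smul, mul_one]
      _ = _ := by rw [← mul_assoc, U.star_mul_eq_one, one_mul]
  have hM := Matrix.eta_fin_two (U : Matrix (Fin 2) (Fin 2) ℂ)
  set M := (U : Matrix (Fin 2) (Fin 2) ℂ) with hMdef
  rw [Matrix.adjugate_fin_two] at h1
  have h00 : (starRingEnd ℂ) (M 0 0) = M 1 1 := by simpa using congrFun (congrFun h1 0) 0
  have h10 : (starRingEnd ℂ) (M 0 1) = - M 1 0 := by simpa using congrFun (congrFun h1 1) 0
  have hd : M 0 0 * M 1 1 - M 0 1 * M 1 0 = 1 := by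
    rw [← Matrix.det_fin_two]
    exact U.det_eq_one
  have h : ‖M 0 0‖ ^ 2 + ‖M 0 1‖ ^ 2 = 1 := by
    have : (‖M 0 0‖ : ℂ) ^ 2 + (‖M 0 1‖ : ℂ) ^ 2 = 1 := by
      rw [← Complex.mul_conj', ← Complex.mul_conj', h00, h10]
      linear_combination hd
    exact_mod_cast this
  refine ⟨M 0 0, M 0 1, h, Subtype.ext ?_⟩
  rw [coe_ofPair, h00, h10, neg_neg]
  exact hM

/-- The quarter turn, representing the non-trivial element of the Weyl group. -/
def weyl : SU2 := ofPair 0 1 (by simp)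

end SU2

namespace Hyp3

/-- The diagonal matrix with entries `e ^ (s / 2)` and `e ^ (-s / 2)`, the translation by `s` along
a geodesic through the base point. -/
def diagSL (s : ℝ) : SL(2, ℂ) :=
  ⟨Matrix.diagonal ![((Real.exp (s / 2) : ℝ) : ℂ), ((Real.exp (-s / 2) : ℝ) : ℂ)], by
    rw [Matrix.det_diagonal, Fin.prod_univ_two]
    simp only [Matrix.cons_val_zero, Matrix.cons_val_one]
    rw [← Complex.ofReal_mul, ← Real.exp_add]
    simp [← add_div]⟩

/-- The point of polar coordinates `(U, s)`: the point at distance `|s|` from the base point on the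
geodesic rotated by `U`. -/
def polar (U : SU2) (s : ℝ) : Hyp3 := slAct (U.toSL * diagSL s) base

theorem coe_polar (U : SU2) (s : ℝ) : (polar U s).1 =
    (U : Matrix (Fin 2) (Fin 2) ℂ) *
      Matrix.diagonal ![((Real.exp s : ℝ) : ℂ), ((Real.exp (-s) : ℝ) : ℂ)] *
        (U : Matrix (Fin 2) (Fin 2) ℂ)ᴴ := by
  have h : Matrix.diagonal ![((Real.exp s : ℝ) : ℂ), ((Real.exp (-s) : ℝ) : ℂ)] =
      (diagSL s).1 * (diagSL s).1ᴴ := by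
    simp only [diagSL, Matrix.diagonal_conjTranspose, Matrix.diagonal_mul_diagonal]
    congr 1
    funext i
    have hr : ∀ x : ℝ, ((Real.exp x : ℝ) : ℂ) =
        ((Real.exp (x / 2) : ℝ) : ℂ) * star ((Real.exp (x / 2) : ℝ) : ℂ) := by
      intro x
      rw [Complex.star_def, Complex.conj_ofReal, ← Complex.ofReal_mul, ← Real.exp_add, add_halves]
    fin_cases i
    · exact hr s
    · exact hr (-s)
  rw [h]
  simp [polar, slAct, base, SU2.coe_toSL, Matrix.mul_assoc]

theorem polar_weyl (U : SU2) (s : ℝ) : polar (U * SU2.weyl) s = polar U (-s) := by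
  apply Subtype.ext
  have h : (SU2.weyl : Matrix (Fin 2) (Fin 2) ℂ) *
      Matrix.diagonal ![((Real.exp s : ℝ) : ℂ), ((Real.exp (-s) : ℝ) : ℂ)] *
        (SU2.weyl : Matrix (Fin 2) (Fin 2) ℂ)ᴴ =
      Matrix.diagonal ![((Real.exp (-s) : ℝ) : ℂ), ((Real.exp (- -s) : ℝ) : ℂ)] := by
    ext i j
    fin_cases i <;> fin_cases j <;>
      simp [SU2.weyl, Matrix.mul_apply, Fin.sum_univ_two, Matrix.vecMul_diagonal]
  rw [coe_polar, coe_polar, ← h]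
  simp [Matrix.mul_assoc]

theorem continuous_polar : Continuous fun p : SU2 × ℝ => polar p.1 p.2 := by
  refine Continuous.subtype_mk (f := fun p : SU2 × ℝ => (polar p.1 p.2).1) ?_
    fun p => (polar p.1 p.2).2
  simp only [coe_polar]
  have h1 : Continuous fun p : SU2 × ℝ => (p.1 : Matrix (Fin 2) (Fin 2) ℂ) := by fun_prop
  refine Continuous.matrix_mul (Continuous.matrix_mul h1 ?_) h1.matrix_conjTranspose
  refine Continuous.matrix_diagonal (continuous_pi fun i => ?_)
  fin_cases i
  · simp; fun_prop
  · simp; fun_prop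

theorem hdist_base (P : Hyp3) : hdist base P = Real.arcosh (P.1.trace.re / 2) := by
  simp [hdist, base]

theorem trace_polar (U : SU2) (s : ℝ) : (polar U s).1.trace.re / 2 = Real.cosh s := by
  rw [coe_polar, Matrix.mul_assoc, Matrix.trace_mul_comm, Matrix.mul_assoc, U.star_mul_eq_one,
    mul_one, Matrix.trace_fin_two, Real.cosh_eq]
  simp [-Complex.ofReal_exp]

theorem hdist_base_polar (U : SU2) (s : ℝ) : hdist base (polar U s) = |s| := by
  rw [hdist_base, trace_polar, ← Real.cosh_abs, Real.arcosh_cosh (abs_nonneg s)]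

theorem eigenvalues_mul_eigenvalues (P : Hyp3) :
    P.2.1.isHermitian.eigenvalues 0 * P.2.1.isHermitian.eigenvalues 1 = 1 := by
  have h := P.2.1.isHermitian.det_eq_prod_eigenvalues
  rw [Fin.prod_univ_two, ← RCLike.ofReal_mul] at h
  exact (RCLike.ofReal_inj (K := ℂ)).1 (by rw [RCLike.ofReal_one]; exact h.symm.trans P.2.2)

/-- The spectral theorem: polar coordinates cover hyperbolic space. -/
theorem exists_eq_polar (P : Hyp3) : ∃ U : SU2, ∃ s : ℝ, 0 ≤ s ∧ P = polar U s := by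
  suffices h : ∃ U : SU2, ∃ s : ℝ, P = polar U s by
    obtain ⟨U, s, rfl⟩ := h
    rcases le_total 0 s with hs | hs
    · exact ⟨U, s, hs, rfl⟩
    · exact ⟨U * SU2.weyl, -s, by linarith, by rw [polar_weyl, neg_neg]⟩
  have hH := P.2.1.isHermitian
  have hpos := P.2.1.eigenvalues_pos
  have hprod := eigenvalues_mul_eigenvalues P
  set V := (hH.eigenvectorUnitary : Matrix (Fin 2) (Fin 2) ℂ) with hV
  have hVV : V * Vᴴ = 1 := Unitary.mul_star_self_of_mem hH.eigenvectorUnitary.2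
  have hdet : V.det * star V.det = 1 := by
    rw [← Matrix.det_conjTranspose, ← Matrix.det_mul, hVV, Matrix.det_one]
  -- the eigenbasis is rescaled by a phase in order to have determinant `1`
  set E := Matrix.diagonal ![1, star V.det] with hE
  have hEE : E * Eᴴ = 1 := by
    rw [hE, Matrix.diagonal_conjTranspose, Matrix.diagonal_mul_diagonal, ← Matrix.diagonal_one]
    congr 1
    funext i
    fin_cases i
    · simp
    · simpa [mul_comm] using hdet
  have hU : V * E ∈ Matrix.specialUnitaryGroup (Fin 2) ℂ := by
    rw [Matrix.mem_specialUnitaryGroup_iff, Matrix.mem_unitaryGroup_iff,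
      Matrix.star_eq_conjTranspose]
    constructor
    · rw [Matrix.conjTranspose_mul, Matrix.mul_assoc, ← Matrix.mul_assoc E, hEE, one_mul, hVV]
    · rw [Matrix.det_mul, hE, Matrix.det_diagonal]
      simpa using hdet
  refine ⟨⟨V * E, hU⟩, Real.log (hH.eigenvalues 0), Subtype.ext ?_⟩
  rw [coe_polar]
  have h1 : Real.exp (-Real.log (hH.eigenvalues 0)) = hH.eigenvalues 1 := by
    rw [Real.exp_neg, Real.exp_log (hpos 0)]
    exact inv_eq_of_mul_eq_one_right hprod
  rw [h1, Real.exp_log (hpos 0)]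
  set D := Matrix.diagonal ![((hH.eigenvalues 0 : ℝ) : ℂ), ((hH.eigenvalues 1 : ℝ) : ℂ)] with hD
  have hED : E * D = D * E := by
    rw [hE, hD, Matrix.diagonal_mul_diagonal, Matrix.diagonal_mul_diagonal]
    congr 1
    funext i
    ring
  have hs := hH.spectral_theorem
  rw [Unitary.conjStarAlgAut_apply] at hs
  have hD' : Matrix.diagonal (RCLike.ofReal ∘ hH.eigenvalues) = D := by
    rw [hD]
    congr 1
    funext i
    fin_cases i <;> rfl
  rw [hD'] at hs
  calc P.1 = V * D * Vᴴ := hs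
    _ = V * (E * D * Eᴴ) * Vᴴ := by rw [hED, Matrix.mul_assoc D, hEE, mul_one]
    _ = _ := by simp [Matrix.mul_assoc]

/-- Real powers act on polar coordinates by scaling the radius. -/
theorem power_polar (c : ℝ) (U : SU2) (s : ℝ) : power c (polar U s) = polar U (c * s) := by
  set P := polar U s with hP
  have hH := P.2.1.isHermitian
  have hprod := eigenvalues_mul_eigenvalues P
  have hsum : hH.eigenvalues 0 + hH.eigenvalues 1 = Real.exp s + Real.exp (-s) := by
    have h := hH.trace_eq_sum_eigenvalues
    rw [Fin.sum_univ_two] at h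
    have h2 := trace_polar U s
    rw [← hP, h, Real.cosh_eq] at h2
    have h3 : (((hH.eigenvalues 0 : ℝ) : ℂ) + ((hH.eigenvalues 1 : ℝ) : ℂ)).re / 2 =
      (Real.exp s + Real.exp (-s)) / 2 := h2
    rw [Complex.add_re, Complex.ofReal_re, Complex.ofReal_re] at h3
    linarith
  have hee : Real.exp s * Real.exp (-s) = 1 := by rw [← Real.exp_add]; simp
  -- on the spectrum the power function agrees with the affine function `α + β x`
  obtain ⟨α, β, h1, h2⟩ : ∃ α β : ℝ, α + β * Real.exp s = Real.exp (c * s) ∧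
      α + β * Real.exp (-s) = Real.exp (-(c * s)) := by
    rcases eq_or_ne s 0 with rfl | hs
    · exact ⟨1, 0, by simp, by simp⟩
    · have hne : Real.exp s - Real.exp (-s) ≠ 0 := by
        rw [sub_ne_zero]
        intro h
        exact hs (by linarith [Real.exp_injective h])
      refine ⟨Real.exp (c * s) - (Real.exp (c * s) - Real.exp (-(c * s))) /
        (Real.exp s - Real.exp (-s)) * Real.exp s, (Real.exp (c * s) - Real.exp (-(c * s))) /
        (Real.exp s - Real.exp (-s)), by ring, ?_⟩
      field_simp
      ring
  have hμ : ∀ i, hH.eigenvalues i ^ c = α + β * hH.eigenvalues i := by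
    have hor : ∀ i, hH.eigenvalues i = Real.exp s ∨ hH.eigenvalues i = Real.exp (-s) := by
      intro i
      have : (hH.eigenvalues i - Real.exp s) * (hH.eigenvalues i - Real.exp (-s)) = 0 := by
        fin_cases i
        · simp only [Fin.zero_eta]
          linear_combination hee - hprod + hH.eigenvalues 0 * hsum
        · simp only [Fin.mk_one]
          linear_combination hee - hprod + hH.eigenvalues 1 * hsum
      rcases mul_eq_zero.1 this with h | h
      · exact .inl (by linarith)
      · exact .inr (by linarith)
    intro i
    rcases hor i with h | h
    · rw [h, h1, ← Real.exp_mul, mul_comm]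
    · rw [h, h2, ← Real.exp_mul]
      congr 1
      ring
  have hs := hH.spectral_theorem
  rw [Unitary.conjStarAlgAut_apply] at hs
  set V := (hH.eigenvectorUnitary : Matrix (Fin 2) (Fin 2) ℂ) with hV
  have hVV : V * star V = 1 := Unitary.mul_star_self_of_mem hH.eigenvectorUnitary.2
  apply Subtype.ext
  have hL : (power c P).1 = (α : ℂ) • (1 : Matrix (Fin 2) (Fin 2) ℂ) + (β : ℂ) • P.1 := by
    have hd : Matrix.diagonal (RCLike.ofReal ∘ (fun x : ℝ => x ^ c) ∘ hH.eigenvalues) =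
        (α : ℂ) • (1 : Matrix (Fin 2) (Fin 2) ℂ) +
          (β : ℂ) • Matrix.diagonal (RCLike.ofReal ∘ hH.eigenvalues) := by
      rw [← Matrix.diagonal_one, ← Matrix.diagonal_smul, ← Matrix.diagonal_smul,
        Matrix.diagonal_add]
      congr 1
      funext i
      simp [hμ]
    rw [hs]
    change hH.cfc (fun x => x ^ c) = _
    rw [Matrix.IsHermitian.cfc, Unitary.conjStarAlgAut_apply, hd]
    rw [Matrix.mul_add, Matrix.add_mul]
    congr 1
    · simp
    · simp [hV]
  rw [hL, hP, coe_polar, coe_polar]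
  have hd : Matrix.diagonal ![((Real.exp (c * s) : ℝ) : ℂ), ((Real.exp (-(c * s)) : ℝ) : ℂ)] =
      (α : ℂ) • (1 : Matrix (Fin 2) (Fin 2) ℂ) +
        (β : ℂ) • Matrix.diagonal ![((Real.exp s : ℝ) : ℂ), ((Real.exp (-s) : ℝ) : ℂ)] := by
    rw [← Matrix.diagonal_one, ← Matrix.diagonal_smul, ← Matrix.diagonal_smul,
        Matrix.diagonal_add]
    congr 1
    funext i
    fin_cases i
    · simp only [← h1]; simp
    · simp only [← h2]; simp
  rw [hd, Matrix.mul_add, Matrix.add_mul]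
  congr 1
  · simp [U.mul_star_eq_one]
  · simp

theorem continuous_hdist_base : Continuous fun P : Hyp3 => hdist base P := by
  simp only [hdist_base]
  refine Real.continuousOn_arcosh.comp_continuous ?_ fun P => ?_
  · exact (Complex.continuous_re.comp continuous_subtype_val.matrix_trace).div_const _
  · obtain ⟨U, s, -, rfl⟩ := exists_eq_polar P
    rw [trace_polar]
    exact Real.one_le_cosh s

theorem hdist_base_power {c : ℝ} (hc : 0 ≤ c) (P : Hyp3) :
    hdist base (power c P) = c * hdist base P := by
  obtain ⟨U, s, -, rfl⟩ := exists_eq_polar P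
  rw [power_polar, hdist_base_polar, hdist_base_polar, abs_mul, abs_of_nonneg hc]

/-- The fibre of the amoeba map over a point of polar coordinates `(U, s)` is `U diag(s) SU(2)`. -/
theorem slAct_base_eq_polar_iff (A : SL(2, ℂ)) (U : SU2) (s : ℝ) :
    slAct A base = polar U s ↔ ∃ W : SU2, A = U.toSL * diagSL s * W.toSL := by
  set B := U.toSL * diagSL s with hB
  constructor
  · intro h
    have h1 : A.1 * A.1ᴴ = B.1 * B.1ᴴ := by
      simpa [slAct, polar, base, hB] using congrArg Subtype.val h
    have hBB : (B⁻¹).1 * B.1 = 1 := by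
      rw [← Matrix.SpecialLinearGroup.coe_mul, inv_mul_cancel]
      rfl
    refine ⟨⟨(B⁻¹ * A).1, ?_⟩, ?_⟩
    · rw [Matrix.mem_specialUnitaryGroup_iff, Matrix.mem_unitaryGroup_iff,
        Matrix.star_eq_conjTranspose]
      refine ⟨?_, (B⁻¹ * A).2⟩
      calc (B⁻¹ * A).1 * (B⁻¹ * A).1ᴴ = (B⁻¹).1 * (A.1 * A.1ᴴ) * ((B⁻¹).1)ᴴ := by
            simp [Matrix.mul_assoc]
        _ = ((B⁻¹).1 * B.1) * ((B⁻¹).1 * B.1)ᴴ := by rw [h1]; simp [Matrix.mul_assoc]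
        _ = 1 := by rw [hBB]; simp
    · exact (mul_inv_cancel_left B A).symm
  · rintro ⟨W, rfl⟩
    apply Subtype.ext
    simp only [hB, slAct, polar, base, Matrix.SpecialLinearGroup.coe_mul, SU2.coe_toSL,
      Matrix.conjTranspose_mul, mul_one]
    calc _ = (U.1 * (diagSL s).1) * (W.1 * W.1ᴴ) * ((diagSL s).1ᴴ * U.1ᴴ) := by
          simp only [Matrix.mul_assoc]
      _ = _ := by rw [W.mul_star_eq_one, mul_one]

theorem polar_mem_hypAmoeba_iff (f : MvPolynomial (Fin 2 × Fin 2) ℂ) (U : SU2) (s : ℝ) :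
    polar U s ∈ hypAmoeba (zeroLocus f) ↔
      ∃ W : SU2, MvPolynomial.eval (fun ij => (U.1 * (diagSL s).1 * W.1) ij.1 ij.2) f = 0 := by
  constructor
  · rintro ⟨g, ⟨A, rfl, hA⟩, hg⟩
    obtain ⟨W, rfl⟩ := (slAct_base_eq_polar_iff A U s).1 hg
    exact ⟨W, hA⟩
  · rintro ⟨W, hW⟩
    exact ⟨_, ⟨U.toSL * diagSL s * W.toSL, rfl, hW⟩, (slAct_base_eq_polar_iff _ U s).2 ⟨W, rfl⟩⟩

end Hyp3

/-! ### Expansion of a form along a torus -/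

section Fibre

variable {R S : Type*} [CommRing R] [Algebra ℂ R] [CommRing S] [Algebra ℂ S]

theorem MvPolynomial.IsHomogeneous.sum_exponent_eq {σ : Type*} [Fintype σ] {d : ℕ}
    {f : MvPolynomial σ ℂ} (hf : f.IsHomogeneous d) {m : σ →₀ ℕ} (hm : m ∈ f.support) :
    ∑ i, m i = d := by
  rw [← Finsupp.degree_eq_sum, Finsupp.degree_eq_weight_one]
  exact hf (MvPolynomial.mem_support_iff.1 hm)

theorem MvPolynomial.IsHomogeneous.aeval_mul {σ : Type*} [Fintype σ] {d : ℕ} {f : MvPolynomial σ ℂ}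
    (hf : f.IsHomogeneous d) (c : R) (g : σ → R) :
    MvPolynomial.aeval (fun i => c * g i) f = c ^ d * MvPolynomial.aeval g f := by
  rw [MvPolynomial.aeval_def, MvPolynomial.aeval_def, MvPolynomial.eval₂_eq',
    MvPolynomial.eval₂_eq', Finset.mul_sum]
  refine Finset.sum_congr rfl fun m hm => ?_
  simp_rw [mul_pow]
  rw [Finset.prod_mul_distrib, Finset.prod_pow_eq_pow_sum, hf.sum_exponent_eq hm]
  ring

/-- The polynomial `y ↦ f (U diag(y, 1) W)`. -/
def fibrePoly (U W : Matrix (Fin 2) (Fin 2) R) :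
    MvPolynomial (Fin 2 × Fin 2) ℂ →ₐ[ℂ] Polynomial R :=
  MvPolynomial.aeval fun ij => Polynomial.C (U ij.1 0 * W 0 ij.2) * Polynomial.X +
    Polynomial.C (U ij.1 1 * W 1 ij.2)

theorem eval_fibrePoly (U W : Matrix (Fin 2) (Fin 2) R) (f : MvPolynomial (Fin 2 × Fin 2) ℂ)
    (y : R) : (fibrePoly U W f).eval y =
      MvPolynomial.aeval (fun ij => (U * Matrix.diagonal ![y, 1] * W) ij.1 ij.2) f := by
  have h := MvPolynomial.comp_aeval_apply (fun ij : Fin 2 × Fin 2 =>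
    Polynomial.C (U ij.1 0 * W 0 ij.2) * Polynomial.X + Polynomial.C (U ij.1 1 * W 1 ij.2))
    ((Polynomial.aeval y : Polynomial R →ₐ[R] R).restrictScalars ℂ) f
  simp only [AlgHom.restrictScalars_apply, Polynomial.coe_aeval_eq_eval] at h
  rw [fibrePoly, h]
  congr 2
  funext ij
  simp [Matrix.mul_apply, Fin.sum_univ_two, Matrix.diagonal_apply]
  ring

theorem map_fibrePoly (φ : R →ₐ[ℂ] S) (U W : Matrix (Fin 2) (Fin 2) R)
    (f : MvPolynomial (Fin 2 × Fin 2) ℂ) :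
    (fibrePoly U W f).map (φ : R →+* S) = fibrePoly (U.map φ) (W.map φ) f := by
  have h := MvPolynomial.comp_aeval_apply (fun ij : Fin 2 × Fin 2 =>
    Polynomial.C (U ij.1 0 * W 0 ij.2) * Polynomial.X + Polynomial.C (U ij.1 1 * W 1 ij.2))
    (Polynomial.mapAlgHom φ) f
  simp only [Polynomial.coe_mapAlgHom] at h
  rw [fibrePoly, h, fibrePoly]
  congr 2
  funext ij
  simp

theorem natDegree_fibrePoly_le (U W : Matrix (Fin 2) (Fin 2) R) {d : ℕ}
    {f : MvPolynomial (Fin 2 × Fin 2) ℂ} (hf : f.IsHomogeneous d) :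
    (fibrePoly U W f).natDegree ≤ d := by
  rw [fibrePoly, MvPolynomial.aeval_def, MvPolynomial.eval₂_eq']
  refine Polynomial.natDegree_sum_le_of_forall_le _ _ fun m hm => ?_
  refine (Polynomial.natDegree_C_mul_le _ _).trans ?_
  refine (Polynomial.natDegree_prod_le _ _).trans ?_
  rw [← hf.sum_exponent_eq hm]
  refine Finset.sum_le_sum fun i _ => ?_
  refine Polynomial.natDegree_pow_le.trans ?_
  exact (Nat.mul_le_mul_left _ Polynomial.natDegree_linear_le).trans (mul_one _).le

theorem aeval_eq_sum_fibrePoly (U W : Matrix (Fin 2) (Fin 2) R) {d : ℕ}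
    {f : MvPolynomial (Fin 2 × Fin 2) ℂ} (hf : f.IsHomogeneous d) (y : R) :
    MvPolynomial.aeval (fun ij => (U * Matrix.diagonal ![y, 1] * W) ij.1 ij.2) f =
      ∑ j ∈ Finset.range (d + 1), (fibrePoly U W f).coeff j * y ^ j := by
  rw [← eval_fibrePoly, Polynomial.eval_eq_sum_range'
    (Nat.lt_succ_of_le (natDegree_fibrePoly_le U W hf))]

theorem fibrePoly_smul_left (c : R) (U W : Matrix (Fin 2) (Fin 2) R) {d : ℕ}
    {f : MvPolynomial (Fin 2 × Fin 2) ℂ} (hf : f.IsHomogeneous d) :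
    fibrePoly (c • U) W f = Polynomial.C (c ^ d) * fibrePoly U W f := by
  rw [fibrePoly, fibrePoly, Polynomial.C_pow, ← hf.aeval_mul]
  congr 2
  funext ij
  simp only [Matrix.smul_apply, smul_eq_mul, Polynomial.C_mul]
  ring

theorem fibrePoly_smul_right (c : R) (U W : Matrix (Fin 2) (Fin 2) R) {d : ℕ}
    {f : MvPolynomial (Fin 2 × Fin 2) ℂ} (hf : f.IsHomogeneous d) :
    fibrePoly U (c • W) f = Polynomial.C (c ^ d) * fibrePoly U W f := by
  rw [fibrePoly, fibrePoly, Polynomial.C_pow, ← hf.aeval_mul]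
  congr 2
  funext ij
  simp only [Matrix.smul_apply, smul_eq_mul, Polynomial.C_mul]
  ring

end Fibre

/-- The Weyl group exchanges the weights `j` and `d - j`. -/
theorem coeff_fibrePoly_weyl (U W : SU2) {d : ℕ} {f : MvPolynomial (Fin 2 × Fin 2) ℂ}
    (hf : f.IsHomogeneous d) {j : ℕ} (hj : j ≤ d) :
    (fibrePoly (U * SU2.weyl : SU2).1 (star SU2.weyl * W : SU2).1 f).coeff j =
      (fibrePoly U.1 W.1 f).coeff (d - j) := by
  rw [← Polynomial.revAt_le hj, ← Polynomial.coeff_reflect]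
  congr 1
  refine Polynomial.eq_of_infinite_eval_eq _ _ (Set.Infinite.mono (s := {0}ᶜ) ?_ ?_)
  · intro y hy
    have hy : y ≠ 0 := hy
    let _ := invertibleOfNonzero (inv_ne_zero hy)
    have h := Polynomial.eval₂_reflect_mul_pow (RingHom.id ℂ) y⁻¹ d (fibrePoly U.1 W.1 f)
      (natDegree_fibrePoly_le _ _ hf)
    rw [invOf_eq_inv, inv_inv, Polynomial.eval₂_id, Polynomial.eval₂_id] at h
    have h2 : Polynomial.eval y (Polynomial.reflect d (fibrePoly U.1 W.1 f)) =
        y ^ d * Polynomial.eval y⁻¹ (fibrePoly U.1 W.1 f) := by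
      rw [← h, mul_left_comm, ← mul_pow, mul_inv_cancel₀ hy, one_pow, mul_one]
    rw [Set.mem_ofPred_eq, h2, eval_fibrePoly, eval_fibrePoly, ← hf.aeval_mul]
    congr 2
    funext ij
    simp [SU2.weyl, Matrix.mul_apply, Fin.sum_univ_two, Matrix.diagonal_apply]
    field_simp
    ring
  · exact Set.Finite.infinite_compl (Set.finite_singleton 0)

/-! ### The universal coefficients -/

/-- The quaternion with coordinates `x`, as a `2 × 2` matrix with entries in a `ℂ`-algebra. -/
def quatMatrix {R : Type*} [CommRing R] [Algebra ℂ R] (x : Fin 4 → R) : Matrix (Fin 2) (Fin 2) R :=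
  !![x 0 + algebraMap ℂ R Complex.I * x 1, x 2 + algebraMap ℂ R Complex.I * x 3;
    -x 2 + algebraMap ℂ R Complex.I * x 3, x 0 - algebraMap ℂ R Complex.I * x 1]

theorem map_quatMatrix {R S : Type*} [CommRing R] [Algebra ℂ R] [CommRing S] [Algebra ℂ S]
    (φ : R →ₐ[ℂ] S) (x : Fin 4 → R) : (quatMatrix x).map φ = quatMatrix fun i => φ (x i) := by
  ext i j
  fin_cases i <;> fin_cases j <;> simp [quatMatrix]

/-- The coefficient of `y ^ j` in `f (U diag(y, 1) W)`, as a polynomial in the quaternionic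
coordinates of `U` and `W`. -/
def weightCoeff (j : ℕ) :
    MvPolynomial (Fin 2 × Fin 2) ℂ →ₗ[ℂ] MvPolynomial (Fin 2 × Fin 4) ℂ :=
  ((Polynomial.lcoeff (MvPolynomial (Fin 2 × Fin 4) ℂ) j).restrictScalars ℂ).comp
    (fibrePoly (quatMatrix fun i => MvPolynomial.X (0, i))
      (quatMatrix fun i => MvPolynomial.X (1, i))).toLinearMap

theorem eval_weightCoeff (x : Fin 2 × Fin 4 → ℂ) (j : ℕ) (f : MvPolynomial (Fin 2 × Fin 2) ℂ) :
    MvPolynomial.eval x (weightCoeff j f) =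
      (fibrePoly (quatMatrix fun i => x (0, i)) (quatMatrix fun i => x (1, i)) f).coeff j := by
  have h := map_fibrePoly (MvPolynomial.aeval x : MvPolynomial (Fin 2 × Fin 4) ℂ →ₐ[ℂ] ℂ)
    (quatMatrix fun i => MvPolynomial.X (0, i)) (quatMatrix fun i => MvPolynomial.X (1, i)) f
  rw [map_quatMatrix, map_quatMatrix] at h
  simp only [MvPolynomial.aeval_X] at h
  rw [← h, Polynomial.coeff_map]
  rfl

/-- A finite set of exponents containing the supports of all the polynomials `weightCoeff j f`
for forms `f` of degree `d` and `j ≤ d`. -/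
def weightSupport (d : ℕ) : Finset (Fin 2 × Fin 4 →₀ ℕ) :=
  insert 0 ((Finset.finsuppAntidiag Finset.univ d).biUnion fun m =>
    (Finset.range (d + 1)).biUnion fun j => (weightCoeff j (MvPolynomial.monomial m 1)).support)

theorem weightSupport_nonempty (d : ℕ) : (weightSupport d).Nonempty :=
  ⟨0, Finset.mem_insert_self _ _⟩

theorem support_weightCoeff_subset {d j : ℕ} (hj : j ≤ d) {f : MvPolynomial (Fin 2 × Fin 2) ℂ}
    (hf : f.IsHomogeneous d) : (weightCoeff j f).support ⊆ weightSupport d := by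
  intro n hn
  rw [MvPolynomial.mem_support_iff, MvPolynomial.as_sum f, map_sum, MvPolynomial.coeff_sum] at hn
  obtain ⟨m, hm, hmn⟩ := Finset.exists_ne_zero_of_sum_ne_zero hn
  refine Finset.mem_insert_of_mem (Finset.mem_biUnion.2 ⟨m, ?_, Finset.mem_biUnion.2 ⟨j, ?_, ?_⟩⟩)
  · rw [Finset.mem_finsuppAntidiag]
    exact ⟨hf.sum_exponent_eq hm, Finset.subset_univ _⟩
  · exact Finset.mem_range.2 (Nat.lt_succ_of_le hj)
  · rw [MvPolynomial.mem_support_iff]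
    intro h0
    apply hmn
    rw [← mul_one (MvPolynomial.coeff m f), ← smul_eq_mul, ← MvPolynomial.smul_monomial, map_smul,
      MvPolynomial.coeff_smul, h0, smul_zero]

/-- The size of the weight `j` part of a form of degree `d`: the `ℓ¹` norm of its coefficients. -/
def weightNorm (d j : ℕ) (f : MvPolynomial (Fin 2 × Fin 2) ℂ) : ℝ :=
  ∑ m ∈ weightSupport d, ‖(weightCoeff j f).coeff m‖

theorem weightNorm_nonneg (d j : ℕ) (f : MvPolynomial (Fin 2 × Fin 2) ℂ) : 0 ≤ weightNorm d j f :=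
  Finset.sum_nonneg fun _ _ => norm_nonneg _

theorem norm_eval_weightCoeff_le {d j : ℕ} (hj : j ≤ d) {f : MvPolynomial (Fin 2 × Fin 2) ℂ}
    (hf : f.IsHomogeneous d) {x : Fin 2 × Fin 4 → ℂ} (hx : ∀ i, ‖x i‖ ≤ 1) :
    ‖MvPolynomial.eval x (weightCoeff j f)‖ ≤ weightNorm d j f := by
  rw [MvPolynomial.eval_eq', weightNorm]
  refine (norm_sum_le _ _).trans ?_
  refine (Finset.sum_le_sum fun m _ => ?_).trans
    (Finset.sum_le_sum_of_subset_of_nonneg (support_weightCoeff_subset hj hf)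
      fun _ _ _ => norm_nonneg _)
  rw [norm_mul, norm_prod]
  refine mul_le_of_le_one_right (norm_nonneg _) (Finset.prod_le_one (fun _ _ => norm_nonneg _) ?_)
  intro i _
  rw [norm_pow]
  exact pow_le_one₀ (norm_nonneg _) (hx i)

/-- Unit quaternions have coordinates in `[-1, 1]`. -/
theorem SU2.exists_eq_quatMatrix (U : SU2) :
    ∃ x : Fin 4 → ℝ, (∀ i, |x i| ≤ 1) ∧ U.1 = quatMatrix fun i => (x i : ℂ) := by
  obtain ⟨a, b, h, rfl⟩ := U.exists_eq_ofPair
  have ha : ‖a‖ ≤ 1 := by nlinarith [sq_nonneg ‖b‖, norm_nonneg a]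
  have hb : ‖b‖ ≤ 1 := by nlinarith [sq_nonneg ‖a‖, norm_nonneg b]
  refine ⟨![a.re, a.im, b.re, b.im], ?_, ?_⟩
  · intro i
    fin_cases i
    · exact (Complex.abs_re_le_norm a).trans ha
    · exact (Complex.abs_im_le_norm a).trans ha
    · exact (Complex.abs_re_le_norm b).trans hb
    · exact (Complex.abs_im_le_norm b).trans hb
  · ext i j
    fin_cases i <;> fin_cases j <;> apply Complex.ext <;> simp [quatMatrix]

theorem norm_coeff_fibrePoly_le (U W : SU2) {d j : ℕ} (hj : j ≤ d)
    {f : MvPolynomial (Fin 2 × Fin 2) ℂ} (hf : f.IsHomogeneous d) :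
    ‖(fibrePoly U.1 W.1 f).coeff j‖ ≤ weightNorm d j f := by
  obtain ⟨x, hx, hU⟩ := U.exists_eq_quatMatrix
  obtain ⟨y, hy, hW⟩ := W.exists_eq_quatMatrix
  have h := eval_weightCoeff (fun p : Fin 2 × Fin 4 => ((![x, y] p.1 p.2 : ℝ) : ℂ)) j f
  simp only [Matrix.cons_val_zero, Matrix.cons_val_one] at h
  rw [← hU, ← hW] at h
  rw [← h]
  refine norm_eval_weightCoeff_le hj hf fun p => ?_
  rw [Complex.norm_real, Real.norm_eq_abs]
  obtain ⟨i, k⟩ := p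
  fin_cases i
  · exact hx k
  · exact hy k

/-- By the symmetry under the Weyl group the coefficient of weight `d - j` is bounded by the size of
the weight `j` part. -/
theorem norm_coeff_fibrePoly_sub_le (U W : SU2) {d j : ℕ} (hj : j ≤ d)
    {f : MvPolynomial (Fin 2 × Fin 2) ℂ} (hf : f.IsHomogeneous d) :
    ‖(fibrePoly U.1 W.1 f).coeff (d - j)‖ ≤ weightNorm d j f := by
  rw [← coeff_fibrePoly_weyl U W hf hj]
  exact norm_coeff_fibrePoly_le _ _ hj hf

namespace Hyp3

/-- The translation by `s` is proportional to `diag(e ^ s, 1)`. -/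
theorem eval_mul_diagSL_mul {d : ℕ} {f : MvPolynomial (Fin 2 × Fin 2) ℂ} (hf : f.IsHomogeneous d)
    (U W : Matrix (Fin 2) (Fin 2) ℂ) (s : ℝ) :
    MvPolynomial.eval (fun ij => (U * (diagSL s).1 * W) ij.1 ij.2) f =
      ((Real.exp (-s / 2) : ℝ) : ℂ) ^ d * ∑ j ∈ Finset.range (d + 1),
        (fibrePoly U W f).coeff j * ((Real.exp s : ℝ) : ℂ) ^ j := by
  rw [← aeval_eq_sum_fibrePoly U W hf]
  have h : (fun ij : Fin 2 × Fin 2 => (U * (diagSL s).1 * W) ij.1 ij.2) = fun ij =>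
      ((Real.exp (-s / 2) : ℝ) : ℂ) *
        (U * Matrix.diagonal ![((Real.exp s : ℝ) : ℂ), 1] * W) ij.1 ij.2 := by
    have h1 : (diagSL s).1 = ((Real.exp (-s / 2) : ℝ) : ℂ) •
        Matrix.diagonal ![((Real.exp s : ℝ) : ℂ), 1] := by
      rw [diagSL, ← Matrix.diagonal_smul]
      refine congrArg Matrix.diagonal (funext fun i => ?_)
      fin_cases i
      · simp only [Fin.zero_eta, Matrix.cons_val_zero, Pi.smul_apply, smul_eq_mul]
        rw [← Complex.ofReal_mul, ← Real.exp_add]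
        congr 2
        ring
      · simp
    funext ij
    rw [h1, Matrix.mul_smul, Matrix.smul_mul, Matrix.smul_apply, smul_eq_mul]
  rw [← MvPolynomial.coe_aeval_eq_eval, h, RingHom.coe_coe, hf.aeval_mul]

theorem polar_mem_hypAmoeba_iff_of_isHomogeneous {d : ℕ} {f : MvPolynomial (Fin 2 × Fin 2) ℂ}
    (hf : f.IsHomogeneous d) (U : SU2) (s : ℝ) :
    polar U s ∈ hypAmoeba (zeroLocus f) ↔
      ∃ W : SU2, ∑ j ∈ Finset.range (d + 1),
        (fibrePoly U.1 W.1 f).coeff j * ((Real.exp s : ℝ) : ℂ) ^ j = 0 := by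
  rw [polar_mem_hypAmoeba_iff]
  refine exists_congr fun W => ?_
  rw [eval_mul_diagSL_mul hf, mul_eq_zero, or_iff_right]
  exact pow_ne_zero _ (Complex.ofReal_ne_zero.2 (Real.exp_pos _).ne')

end Hyp3

/-! ### Continuous logarithms and winding numbers -/

/-- The power map `z ↦ z ^ n` of the unit circle has a continuous logarithm only for `n = 0`. -/
theorem eq_zero_of_zpow_eq_exp {n : ℤ} {ℓ : ℂ → ℂ}
    (hc : Continuous fun θ : ℝ => ℓ (Complex.exp (θ * Complex.I)))
    (h : ∀ z : ℂ, ‖z‖ = 1 → z ^ n = Complex.exp (ℓ z)) : n = 0 := by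
  have key : ∀ θ : ℝ, ∃ k : ℤ, ℓ (Complex.exp (θ * Complex.I)) - n * (θ * Complex.I)
      = k * (2 * Real.pi * Complex.I) := by
    intro θ
    rw [← Complex.exp_eq_one_iff, Complex.exp_sub, ← h _ (Complex.norm_exp_ofReal_mul_I θ),
      ← Complex.exp_int_mul, div_self (Complex.exp_ne_zero _)]
  choose k hk using key
  have hkc : Continuous k := by
    rw [Int.isClosedEmbedding_coe_real.isInducing.continuous_iff]
    have : ((fun m : ℤ => (m : ℝ)) ∘ k) = fun θ : ℝ =>
        ((ℓ (Complex.exp (θ * Complex.I)) - n * (θ * Complex.I)) /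
          (2 * Real.pi * Complex.I)).re := by
      funext θ
      rw [hk, mul_div_cancel_right₀ _ Complex.two_pi_I_ne_zero]
      simp
    rw [this]
    exact Complex.continuous_re.comp ((hc.sub (by fun_prop)).div_const _)
  have h0 := PreconnectedSpace.constant inferInstance hkc (x := 0) (y := 2 * Real.pi)
  have h1 := hk 0
  have h2 := hk (2 * Real.pi)
  rw [← h0] at h2
  push_cast at h1 h2
  rw [Complex.exp_two_pi_mul_I] at h2
  rw [zero_mul, Complex.exp_zero] at h1
  rw [← h2] at h1
  have h3 : (n : ℂ) * (2 * Real.pi * Complex.I) = 0 := by linear_combination h1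
  simpa [Complex.two_pi_I_ne_zero] using h3

/-- A nowhere vanishing continuous function on the plane has a continuous logarithm. -/
theorem exists_continuous_log {f : ℂ → ℂ} (hf : Continuous f) (h0 : ∀ z, f z ≠ 0) :
    ∃ ℓ : ℂ → ℂ, Continuous ℓ ∧ ∀ z, f z = Complex.exp (ℓ z) := by
  obtain ⟨F, ⟨-, hF⟩, -⟩ := Complex.isCoveringMapOn_exp.existsUnique_continuousMap_lifts ⟨f, hf⟩
    (a₀ := 0) (e₀ := Complex.log (f 0)) (by simp [Complex.exp_log (h0 0)]) (by simpa using h0)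
  exact ⟨F, F.continuous, fun z => (congrFun hF z).symm⟩

/-- If, up to a continuous factor of the form `1 + η` with `‖η‖ < 1`, the function `z ↦ c z ^ n` on
the unit circle extends to a nowhere vanishing function on the plane, then `n = 0`. -/
theorem eq_zero_of_zpow_mul_extends {n : ℤ} {c : ℂ} {f η : ℂ → ℂ}
    (hf : Continuous f) (h0 : ∀ z, f z ≠ 0)
    (hη : ContinuousOn η {0}ᶜ) (hη1 : ∀ z, ‖z‖ = 1 → ‖η z‖ < 1)
    (h : ∀ z, ‖z‖ = 1 → f z = c * z ^ n * (1 + η z)) : n = 0 := by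
  obtain ⟨ℓ, hℓ, hfℓ⟩ := exists_continuous_log hf h0
  have hc : c ≠ 0 := by
    rintro rfl
    exact h0 1 (by rw [h 1 (by simp)]; simp)
  have hs : ∀ z : ℂ, ‖z‖ = 1 → 1 + η z ∈ Complex.slitPlane := fun z hz =>
    Complex.mem_slitPlane_of_norm_lt_one (hη1 z hz)
  have hn : ∀ θ : ℝ, ‖Complex.exp (θ * Complex.I)‖ = 1 := Complex.norm_exp_ofReal_mul_I
  refine eq_zero_of_zpow_eq_exp (ℓ := fun z => ℓ z - Complex.log (1 + η z) - Complex.log c) ?_ ?_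
  · refine Continuous.sub (Continuous.sub (by fun_prop) ?_) continuous_const
    have hη2 : Continuous fun θ : ℝ => η (Complex.exp (θ * Complex.I)) :=
      hη.comp_continuous (by fun_prop) fun θ => Complex.exp_ne_zero _
    exact Continuous.clog (continuous_const.add hη2) fun θ => hs _ (hn θ)
  · intro z hz
    have h1 := Complex.slitPlane_ne_zero (hs z hz)
    rw [Complex.exp_sub, Complex.exp_sub, ← hfℓ, Complex.exp_log h1, Complex.exp_log hc, h z hz]
    field_simp

/-- A disc in `SU(2)`, parametrized by the whole plane through the retraction onto the unit disc,
whose boundary is the maximal torus. -/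
def SU2.disc (z : ℂ) : SU2 :=
  SU2.ofPair (z / (max 1 ‖z‖ : ℝ)) (√(1 - ‖z / (max 1 ‖z‖ : ℝ)‖ ^ 2) : ℝ) (by
    have h : ‖z / (max 1 ‖z‖ : ℝ)‖ ≤ 1 := by
      rw [norm_div, Complex.norm_real, Real.norm_of_nonneg (by positivity)]
      exact div_le_one_of_le₀ (le_max_right _ _) (by positivity)
    rw [Complex.norm_real, Real.norm_of_nonneg (Real.sqrt_nonneg _), Real.sq_sqrt]
    · ring
    · nlinarith [norm_nonneg (z / (max 1 ‖z‖ : ℝ))])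

theorem SU2.continuous_disc : Continuous SU2.disc := by
  have h : Continuous fun z : ℂ => z / (max 1 ‖z‖ : ℝ) := by
    refine continuous_id.div (by fun_prop) fun z => ?_
    exact Complex.ofReal_ne_zero.2 (lt_of_lt_of_le one_pos (le_max_left _ _)).ne'
  refine Continuous.subtype_mk (f := fun z => (SU2.disc z).1) ?_ _
  have h' : Continuous fun z : ℂ => ((√(1 - ‖z / (max 1 ‖z‖ : ℝ)‖ ^ 2) : ℝ) : ℂ) :=
    Complex.continuous_ofReal.comp (Real.continuous_sqrt.comp (continuous_const.sub (h.norm.pow 2)))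
  refine continuous_matrix fun i j => ?_
  fin_cases i <;> fin_cases j
  · exact h
  · exact h'
  · exact (Complex.continuous_conj.comp h').neg
  · exact Complex.continuous_conj.comp h

theorem SU2.disc_of_norm_eq_one {z : ℂ} (hz : ‖z‖ = 1) :
    (SU2.disc z).1 = z⁻¹ • Matrix.diagonal ![z ^ 2, 1] := by
  have h0 : z ≠ 0 := by
    rintro rfl
    simp at hz
  have hzz : (starRingEnd ℂ) z = z⁻¹ := (Complex.inv_eq_conj hz).symm
  ext i j
  fin_cases i <;> fin_cases j <;> simp [SU2.disc, hz, hzz]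
  field_simp

/-- The weight decomposition of a form on a coset of the maximal torus. -/
theorem aeval_mul_disc_mul {d : ℕ} {f : MvPolynomial (Fin 2 × Fin 2) ℂ} (hf : f.IsHomogeneous d)
    (U W : Matrix (Fin 2) (Fin 2) ℂ) (y : ℂ) {z : ℂ} (hz : ‖z‖ = 1) :
    MvPolynomial.aeval (fun ij => (U * Matrix.diagonal ![y, 1] *
        ((SU2.disc z).1 * W)) ij.1 ij.2) f =
      z⁻¹ ^ d * ∑ k ∈ Finset.range (d + 1), (fibrePoly U W f).coeff k * y ^ k * z ^ (2 * k) := by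
  have h1 : (fun ij : Fin 2 × Fin 2 => (U * Matrix.diagonal ![y, 1] *
      ((SU2.disc z).1 * W)) ij.1 ij.2) = fun ij => z⁻¹ *
      (U * Matrix.diagonal ![y * z ^ 2, 1] * W) ij.1 ij.2 := by
    have h2 : Matrix.diagonal ![y, 1] * (SU2.disc z).1 =
        z⁻¹ • Matrix.diagonal ![y * z ^ 2, 1] := by
      rw [SU2.disc_of_norm_eq_one hz, Matrix.mul_smul, Matrix.diagonal_mul_diagonal]
      congr 2
      funext i
      fin_cases i <;> simp
    funext ij
    rw [← Matrix.mul_assoc, Matrix.mul_assoc U, h2, Matrix.mul_smul,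
      Matrix.smul_mul, Matrix.smul_apply, smul_eq_mul]
  rw [h1, hf.aeval_mul, aeval_eq_sum_fibrePoly _ _ hf]
  congr 1
  refine Finset.sum_congr rfl fun k _ => ?_
  rw [mul_pow, ← pow_mul, mul_assoc]

namespace Hyp3

/-- If a fibre of the amoeba map misses the zero locus, the form has winding number zero on each
coset of the maximal torus in the fibre, since these circles bound discs in the fibre. In
particular, only the zero weight can dominate the restriction of the form to such a circle. -/
theorem two_mul_eq_of_dominant {d : ℕ} {f : MvPolynomial (Fin 2 × Fin 2) ℂ}
    (hf : f.IsHomogeneous d) {U : SU2} {s : ℝ} (hU : polar U s ∉ hypAmoeba (zeroLocus f)) (W : SU2)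
    {j : ℕ} (hj : j ≤ d)
    (hdom : ∑ k ∈ (Finset.range (d + 1)).erase j,
        ‖(fibrePoly U.1 W.1 f).coeff k‖ * Real.exp s ^ k <
      ‖(fibrePoly U.1 W.1 f).coeff j‖ * Real.exp s ^ j) : 2 * j = d := by
  set G : ℕ → ℂ := fun k => (fibrePoly U.1 W.1 f).coeff k * ((Real.exp s : ℝ) : ℂ) ^ k with hG
  have hGn : ∀ k, ‖G k‖ = ‖(fibrePoly U.1 W.1 f).coeff k‖ * Real.exp s ^ k := fun k => by
    rw [hG, norm_mul, norm_pow, Complex.norm_real, Real.norm_of_nonneg (Real.exp_pos s).le]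
  simp only [← hGn] at hdom
  have hGj : G j ≠ 0 := by
    rw [← norm_pos_iff]
    exact (Finset.sum_nonneg fun _ _ => norm_nonneg _).trans_lt hdom
  have key : ((2 * j : ℕ) : ℤ) - d = 0 := by
    refine eq_zero_of_zpow_mul_extends (c := G j)
      (f := fun z => MvPolynomial.aeval (fun ij => (U.1 *
        Matrix.diagonal ![((Real.exp s : ℝ) : ℂ), 1] * (SU2.disc z * W).1) ij.1 ij.2) f)
      (η := fun z => (∑ k ∈ (Finset.range (d + 1)).erase j, G k * z ^ (2 * k)) /
        (G j * z ^ (2 * j))) ?_ ?_ ?_ ?_ ?_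
    · change Continuous fun z => MvPolynomial.eval (fun ij : Fin 2 × Fin 2 => (U.1 *
        Matrix.diagonal ![((Real.exp s : ℝ) : ℂ), 1] * (SU2.disc z * W).1) ij.1 ij.2) f
      refine (MvPolynomial.continuous_eval f).comp (continuous_pi fun ij => ?_)
      have h1 : Continuous fun z => U.1 * Matrix.diagonal ![((Real.exp s : ℝ) : ℂ), 1] *
          ((SU2.disc z).1 * W.1) :=
        continuous_const.matrix_mul
          ((continuous_subtype_val.comp SU2.continuous_disc).matrix_mul continuous_const)
      exact h1.matrix_elem _ _
    · intro z hz
      refine hU ((polar_mem_hypAmoeba_iff_of_isHomogeneous hf U s).2 ⟨SU2.disc z * W, ?_⟩)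
      rw [← aeval_eq_sum_fibrePoly _ _ hf]
      exact hz
    · refine ContinuousOn.div (by fun_prop) (by fun_prop) fun z hz => ?_
      exact mul_ne_zero hGj (pow_ne_zero _ hz)
    · intro z hz
      rw [norm_div, norm_mul, norm_pow, hz, one_pow, mul_one, div_lt_one (norm_pos_iff.2 hGj)]
      refine (norm_sum_le _ _).trans_lt (lt_of_le_of_lt (Finset.sum_le_sum fun k _ => ?_) hdom)
      rw [norm_mul, norm_pow, hz, one_pow, mul_one]
    · intro z hz
      have h0 : z ≠ 0 := by
        rintro rfl
        simp at hz
      rw [Submonoid.coe_mul, aeval_mul_disc_mul hf _ _ _ hz,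
        ← Finset.add_sum_erase _ _ (Finset.mem_range.2 (Nat.lt_succ_of_le hj))]
      rw [zpow_sub₀ h0, zpow_natCast, zpow_natCast, inv_pow]
      have hd : z ^ d ≠ 0 := pow_ne_zero _ h0
      change (z ^ d)⁻¹ * (G j * z ^ (2 * j) + ∑ k ∈ _, G k * z ^ (2 * k)) = _
      field_simp
  omega

end Hyp3

/-! ### Uniform lower bounds at generic points -/

/-- If any finite family of non-zero vectors can be simultaneously detected by a functional from
`Φ`, then this can be done with a uniform lower bound. This follows from compactness of the
product of unit spheres. -/
theorem exists_pos_forall_exists_mul_norm_le {ι E : Type*} [Finite ι] [NormedAddCommGroup E]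
    [NormedSpace ℂ E] [FiniteDimensional ℂ E] [Nontrivial E] {Φ : Set (E →ₗ[ℂ] ℂ)}
    (h : ∀ g : ι → E, (∀ i, g i ≠ 0) → ∃ φ ∈ Φ, ∀ i, φ (g i) ≠ 0) :
    ∃ ε : ℝ, 0 < ε ∧ ∀ g : ι → E, ∃ φ ∈ Φ, ∀ i, ε * ‖g i‖ ≤ ‖φ (g i)‖ := by
  have := Fintype.ofFinite ι
  have := FiniteDimensional.proper ℂ E
  have hK : IsCompact (Set.univ.pi fun _ : ι => Metric.sphere (0 : E) 1) :=
    isCompact_univ_pi fun _ => isCompact_sphere 0 1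
  have hP : ∃ ε : ℝ, 0 < ε ∧ ∀ g ∈ Set.univ.pi fun _ : ι => Metric.sphere (0 : E) 1,
      ∃ φ ∈ Φ, ∀ i, ε ≤ ‖φ (g i)‖ := by
    refine hK.induction_on (p := fun s => ∃ ε : ℝ, 0 < ε ∧ ∀ g ∈ s, ∃ φ ∈ Φ, ∀ i, ε ≤ ‖φ (g i)‖)
      ⟨1, one_pos, by simp⟩ ?_ ?_ ?_
    · rintro s t hst ⟨ε, hε, ht⟩
      exact ⟨ε, hε, fun g hg => ht g (hst hg)⟩
    · rintro s t ⟨ε, hε, hs⟩ ⟨ε', hε', ht⟩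
      refine ⟨min ε ε', lt_min hε hε', ?_⟩
      rintro g (hg | hg)
      · obtain ⟨φ, hφ, hφg⟩ := hs g hg
        exact ⟨φ, hφ, fun i => (min_le_left _ _).trans (hφg i)⟩
      · obtain ⟨φ, hφ, hφg⟩ := ht g hg
        exact ⟨φ, hφ, fun i => (min_le_right _ _).trans (hφg i)⟩
    · intro g hg
      obtain ⟨φ, hφ, hφg⟩ := h g fun i => by
        have hi := hg i (Set.mem_univ i)
        rw [mem_sphere_zero_iff_norm] at hi
        rw [← norm_ne_zero_iff, hi]
        exact one_ne_zero
      obtain ⟨ε, hε, hεg⟩ : ∃ ε : ℝ, 0 < ε ∧ ∀ i, ε < ‖φ (g i)‖ := by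
        have h1 : ∀ i, ∀ᶠ ε : ℝ in 𝓝[>] 0, ε < ‖φ (g i)‖ := fun i =>
          nhdsWithin_le_nhds (eventually_lt_nhds (norm_pos_iff.2 (hφg i)))
        obtain ⟨ε, hε, h2⟩ := ((eventually_all.2 h1).and self_mem_nhdsWithin).exists
        exact ⟨ε, h2, hε⟩
      have hφc : Continuous φ := φ.continuous_of_finiteDimensional
      have hev : ∀ᶠ g' in 𝓝 g, ∀ i, ε < ‖φ (g' i)‖ := by
        refine eventually_all.2 fun i => ?_
        have h1 : ContinuousAt (fun g' : ι → E => ‖φ (g' i)‖) g :=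
          (hφc.comp (continuous_apply i)).norm.continuousAt
        exact h1.eventually (lt_mem_nhds (hεg i))
      exact ⟨_, mem_nhdsWithin_of_mem_nhds hev, ε, hε, fun g' hg' => ⟨φ, hφ, fun i => (hg' i).le⟩⟩
  obtain ⟨ε, hε, hP⟩ := hP
  obtain ⟨e, he⟩ := exists_norm_eq E (zero_le_one (α := ℝ))
  refine ⟨ε, hε, fun g => ?_⟩
  classical
  -- zero vectors are replaced by an arbitrary unit vector
  obtain ⟨φ, hφ, hφg⟩ := hP (fun i => if g i = 0 then e else ((‖g i‖⁻¹ : ℝ) : ℂ) • g i)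
      fun i _ => by
    by_cases hi : g i = 0
    · simp [hi, he]
    · simp [hi, norm_smul]
  refine ⟨φ, hφ, fun i => ?_⟩
  by_cases hi : g i = 0
  · simp [hi]
  · have h1 := hφg i
    have hpos := norm_pos_iff.2 hi
    simp only [hi, if_false, map_smul, norm_smul, Complex.norm_real, norm_inv, norm_norm] at h1
    rwa [inv_mul_eq_div, le_div_iff₀ hpos] at h1

/-- Finitely many polynomials with exponents in a finite set `T` are simultaneously comparable with
their `ℓ¹` norms at some real point of any given cube, uniformly in the polynomials. The qualitative
part holds because a product of non-zero polynomials does not vanish on a cube. -/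
theorem exists_pos_forall_mul_sum_norm_coeff_le {σ ι : Type*} [Fintype σ] [Finite ι]
    {T : Finset (σ →₀ ℕ)} (hT : T.Nonempty) (c : σ → ℝ) {δ : ℝ} (hδ : 0 < δ) :
    ∃ ε : ℝ, 0 < ε ∧ ∀ p : ι → MvPolynomial σ ℂ, (∀ i, (p i).support ⊆ T) →
      ∃ x : σ → ℝ, (∀ k, |x k - c k| < δ) ∧ ∀ i,
        ε * ∑ m ∈ T, ‖(p i).coeff m‖ ≤ ‖MvPolynomial.eval (fun k => (x k : ℂ)) (p i)‖ := by
  have := Fintype.ofFinite ι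
  have : Nonempty T := hT.to_subtype
  -- polynomials with exponents in `T`, in terms of their coefficients
  let toPoly : (T → ℂ) →ₗ[ℂ] MvPolynomial σ ℂ :=
    ∑ m : T, (MvPolynomial.monomial m.1).comp (LinearMap.proj m)
  have htoPoly : ∀ a, toPoly a = ∑ m : T, MvPolynomial.monomial m.1 (a m) := fun a => by
    simp [toPoly]
  have hcoeff : ∀ (a : T → ℂ) (m : T), (toPoly a).coeff m.1 = a m := by
    classical
    intro a m
    rw [htoPoly, MvPolynomial.coeff_sum]
    simp only [MvPolynomial.coeff_monomial]
    rw [Finset.sum_eq_single m]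
    · simp
    · intro b _ hb
      rw [if_neg fun h => hb (Subtype.ext h)]
    · simp
  obtain ⟨ε, hε, hb⟩ := exists_pos_forall_exists_mul_norm_le (ι := ι) (E := T → ℂ)
    (Φ := {φ | ∃ x : σ → ℝ, (∀ k, |x k - c k| < δ) ∧
      ∀ a, φ a = MvPolynomial.eval (fun k => (x k : ℂ)) (toPoly a)}) (by
    intro g hg
    have hprod : ∏ i, toPoly (g i) ≠ 0 := by
      rw [Finset.prod_ne_zero_iff]
      intro i _ h0
      apply hg i
      funext m
      have h1 := hcoeff (g i) m
      rw [h0] at h1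
      simpa using h1.symm
    have hinf : ∀ k : σ, ((fun t : ℝ => (t : ℂ)) '' Set.Ioo (c k - δ) (c k + δ)).Infinite :=
      fun k => (Set.Ioo_infinite (by linarith)).image Complex.ofReal_injective.injOn
    obtain ⟨x, hx, hx0⟩ : ∃ x ∈ Set.univ.pi fun k : σ =>
        (fun t : ℝ => (t : ℂ)) '' Set.Ioo (c k - δ) (c k + δ),
        MvPolynomial.eval x (∏ i, toPoly (g i)) ≠ 0 := by
      by_contra hcon
      push Not at hcon
      exact hprod (MvPolynomial.funext_set _ hinf fun x hx => by rw [hcon x hx, map_zero])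
    choose y hy hyx using fun k => hx k (Set.mem_univ k)
    obtain rfl : (fun k => (y k : ℂ)) = x := funext hyx
    refine ⟨(MvPolynomial.aeval fun k => (y k : ℂ)).toLinearMap.comp toPoly,
      ⟨y, fun k => ?_, fun a => rfl⟩, fun i => ?_⟩
    · rw [abs_sub_lt_iff]
      constructor <;> linarith [(hy k).1, (hy k).2]
    · rw [map_prod, Finset.prod_ne_zero_iff] at hx0
      exact hx0 i (Finset.mem_univ i))
  have hcard : (0 : ℝ) < T.card := by exact_mod_cast Finset.card_pos.2 hT
  refine ⟨ε / T.card, by positivity, fun p hp => ?_⟩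
  obtain ⟨φ, ⟨x, hx, hφ⟩, hle⟩ := hb fun i m => (p i).coeff m.1
  refine ⟨x, hx, fun i => ?_⟩
  have h1 := hle i
  have h2 : toPoly (fun m => (p i).coeff m.1) = p i := by
    rw [htoPoly, Finset.sum_coe_sort T fun m => MvPolynomial.monomial m ((p i).coeff m)]
    conv_rhs => rw [MvPolynomial.as_sum (p i)]
    refine (Finset.sum_subset (hp i) fun m _ hm => ?_).symm
    rw [MvPolynomial.notMem_support_iff.1 hm, map_zero]
  rw [hφ, h2] at h1
  refine le_trans ?_ h1
  rw [div_mul_eq_mul_div, mul_div_assoc]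
  refine mul_le_mul_of_nonneg_left ?_ hε.le
  rw [div_le_iff₀ hcard, ← Finset.sum_coe_sort T fun m => ‖(p i).coeff m‖]
  refine (Finset.sum_le_card_nsmul _ _ ‖fun m : T => (p i).coeff m.1‖
    fun m _ => norm_le_pi_norm (fun m : T => (p i).coeff m.1) m).trans ?_
  simp [mul_comm]

/-- Real quaternions close to half a given unit quaternion are positive multiples, by a factor at
most `1`, of unit quaternions close to the given one. -/
theorem SU2.exists_quatMatrix_eq_smul (U : SU2) {N : Set SU2} (hN : N ∈ 𝓝 U) :
    ∃ c : Fin 4 → ℝ, ∃ δ : ℝ, 0 < δ ∧ ∀ x : Fin 4 → ℝ, (∀ i, |x i - c i| < δ) →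
      ∃ V ∈ N, ∃ r : ℝ, 0 < r ∧ r ≤ 1 ∧ quatMatrix (fun i => (x i : ℂ)) = (r : ℂ) • V.1 := by
  obtain ⟨x₀, -, hU⟩ := U.exists_eq_quatMatrix
  obtain ⟨M, hM, hMN⟩ := mem_nhds_subtype _ _ _ |>.1 hN
  set n : (Fin 4 → ℝ) → ℝ := fun x => √(∑ i, x i ^ 2) with hn
  have hnc : Continuous n := by fun_prop
  have hdet : ∀ x : Fin 4 → ℝ, (quatMatrix fun i => (x i : ℂ)).det =
      ((∑ i, x i ^ 2 : ℝ) : ℂ) := by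
    intro x
    rw [Matrix.det_fin_two, Fin.sum_univ_four]
    simp [quatMatrix]
    ring_nf
    simp
    ring
  have hn0 : ∑ i, x₀ i ^ 2 = 1 := by
    have := hdet x₀
    rw [← hU, U.det_eq_one] at this
    exact_mod_cast this.symm
  have hnc0 : n (fun i => x₀ i / 2) = 1 / 2 := by
    simp only [hn, div_pow]
    rw [← Finset.sum_div, hn0]
    rw [show (1 : ℝ) / 2 ^ 2 = (1 / 2) ^ 2 by norm_num, Real.sqrt_sq (by norm_num)]
  have hq : Continuous fun x : Fin 4 → ℝ => quatMatrix fun i => (x i : ℂ) := by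
    refine continuous_matrix fun i j => ?_
    fin_cases i <;> fin_cases j <;> simp [quatMatrix] <;> fun_prop
  have hsm : Tendsto (fun x : Fin 4 → ℝ => (((n x)⁻¹ : ℝ) : ℂ) • quatMatrix fun i => (x i : ℂ))
      (𝓝 fun i => x₀ i / 2) (𝓝 U.1) := by
    have h1 : U.1 = (((n fun i => x₀ i / 2)⁻¹ : ℝ) : ℂ) •
        quatMatrix fun i => ((x₀ i / 2 : ℝ) : ℂ) := by
      rw [hnc0, hU]
      ext i j
      fin_cases i <;> fin_cases j <;> simp [quatMatrix] <;> ring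
    rw [h1]
    refine Tendsto.smul ?_ hq.continuousAt
    refine (Complex.continuous_ofReal.tendsto _).comp ?_
    exact (hnc.continuousAt).inv₀ (by rw [hnc0]; norm_num)
  have hev : ∀ᶠ x in 𝓝 fun i => x₀ i / 2, 0 < n x ∧ n x < 1 ∧
      (((n x)⁻¹ : ℝ) : ℂ) • (quatMatrix fun i => (x i : ℂ)) ∈ M := by
    refine (hnc.continuousAt.eventually (lt_mem_nhds ?_)).and
      ((hnc.continuousAt.eventually (gt_mem_nhds ?_)).and (hsm hM))
    · rw [hnc0]; norm_num
    · rw [hnc0]; norm_num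
  obtain ⟨δ, hδ, hball⟩ := Metric.eventually_nhds_iff.1 hev
  refine ⟨fun i => x₀ i / 2, δ, hδ, fun x hx => ?_⟩
  obtain ⟨h0, h1, h2⟩ := hball (y := x) ((dist_pi_lt_iff hδ).2 fun i => hx i)
  have h0' : ((n x : ℝ) : ℂ) ≠ 0 := Complex.ofReal_ne_zero.2 h0.ne'
  have hnx : n x ^ 2 = ∑ i, x i ^ 2 := Real.sq_sqrt (Finset.sum_nonneg fun _ _ => sq_nonneg _)
  have hmem : (((n x)⁻¹ : ℝ) : ℂ) • (quatMatrix fun i => (x i : ℂ)) ∈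
      Matrix.specialUnitaryGroup (Fin 2) ℂ := by
    have : ‖((x 0 : ℂ) + Complex.I * x 1) / n x‖ ^ 2 +
        ‖((x 2 : ℂ) + Complex.I * x 3) / n x‖ ^ 2 = 1 := by
      rw [norm_div, norm_div, div_pow, div_pow, ← add_div, Complex.norm_real,
        Real.norm_of_nonneg h0.le, div_eq_one_iff_eq (by positivity), hnx, Fin.sum_univ_four,
        Complex.sq_norm, Complex.sq_norm, Complex.normSq_apply, Complex.normSq_apply]
      simp
      ring
    convert! (SU2.ofPair _ _ this).2 using 1
    ext i j
    fin_cases i <;> fin_cases j <;> simp [quatMatrix] <;> ring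
  refine ⟨⟨_, hmem⟩, hMN h2, n x, h0, h1.le, ?_⟩
  rw [smul_smul, ← Complex.ofReal_mul, mul_inv_cancel₀ h0.ne']
  simp

/-- Near any `U` in `SU(2)` there is a point where all the weight parts of a form are comparable
with their sizes, uniformly in the form. -/
theorem exists_pos_forall_mul_weightNorm_le (d : ℕ) (U : SU2) {N : Set SU2} (hN : N ∈ 𝓝 U) :
    ∃ ε : ℝ, 0 < ε ∧ ∀ f : MvPolynomial (Fin 2 × Fin 2) ℂ, f.IsHomogeneous d →
      ∃ V ∈ N, ∃ W : SU2, ∀ j ≤ d,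
        ε * weightNorm d j f ≤ ‖(fibrePoly V.1 W.1 f).coeff j‖ := by
  obtain ⟨c₀, δ₀, hδ₀, h₀⟩ := U.exists_quatMatrix_eq_smul hN
  obtain ⟨c₁, δ₁, hδ₁, h₁⟩ := U.exists_quatMatrix_eq_smul univ_mem
  obtain ⟨ε, hε, h⟩ := exists_pos_forall_mul_sum_norm_coeff_le (ι := Fin (d + 1))
    (weightSupport_nonempty d) (fun p => ![c₀, c₁] p.1 p.2) (lt_min hδ₀ hδ₁)
  refine ⟨ε, hε, fun f hf => ?_⟩
  obtain ⟨x, hx, hle⟩ := h (fun j => weightCoeff j.1 f) fun j =>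
    support_weightCoeff_subset (Nat.le_of_lt_succ j.2) hf
  obtain ⟨V, hV, r, hr, hr1, hrV⟩ := h₀ (fun i => x (0, i)) fun i =>
    (hx (0, i)).trans_le (min_le_left _ _)
  obtain ⟨W, -, t, ht, ht1, htW⟩ := h₁ (fun i => x (1, i)) fun i =>
    (hx (1, i)).trans_le (min_le_right _ _)
  refine ⟨V, hV, W, fun j hj => (hle ⟨j, Nat.lt_succ_of_le hj⟩).trans ?_⟩
  rw [eval_weightCoeff, hrV, htW, fibrePoly_smul_left _ _ _ hf, fibrePoly_smul_right _ _ _ hf,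
    Polynomial.coeff_C_mul, Polynomial.coeff_C_mul, norm_mul, norm_mul, ← mul_assoc]
  refine mul_le_of_le_one_left (norm_nonneg _) ?_
  rw [norm_pow, norm_pow, Complex.norm_real, Complex.norm_real, Real.norm_of_nonneg hr.le,
    Real.norm_of_nonneg ht.le]
  exact mul_le_one₀ (pow_le_one₀ hr.le hr1) (by positivity) (pow_le_one₀ ht.le ht1)

/-! ### Amoeba points outside the ball -/

/-- The zero weight part of a form of degree `d` dominates the other parts at all distances up to
`r` from the base point. By the symmetry under the Weyl group only positive weights are compared. -/
def CentralDominance (d : ℕ) (f : MvPolynomial (Fin 2 × Fin 2) ℂ) (r : ℝ) : Prop :=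
  ∃ n, d = 2 * n ∧ ∀ j ≤ d, n < j →
    weightNorm d j f * Real.exp (r * ((j : ℝ) - n)) ≤ weightNorm d n f

theorem CentralDominance.mono {d : ℕ} {f : MvPolynomial (Fin 2 × Fin 2) ℂ} {r r' : ℝ}
    (h : CentralDominance d f r) (hr : r' ≤ r) : CentralDominance d f r' := by
  obtain ⟨n, hn, h⟩ := h
  refine ⟨n, hn, fun j hj hnj => le_trans ?_ (h j hj hnj)⟩
  have hnj' : (n : ℝ) ≤ j := by exact_mod_cast hnj.le
  refine mul_le_mul_of_nonneg_left (Real.exp_le_exp.2 ?_) (weightNorm_nonneg _ _ _)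
  exact mul_le_mul_of_nonneg_right hr (by linarith)

/-- On any sufficiently long interval a finite sum of exponentials has a point where a single term
dominates: among `d + 2` equidistant points two have the same largest term, which dominates half way
between them. -/
theorem exists_dominant_exponent (d : ℕ) {B : ℝ} (hB : 1 < B) {c : ℕ → ℝ} (hc : ∀ j, 0 ≤ c j)
    (s₀ : ℝ) : ∃ s ∈ Set.Icc s₀ (s₀ + (d + 1) * (2 * Real.log B)), ∃ j ≤ d, ∀ k ≤ d, k ≠ j →
      B * (c k * Real.exp s ^ k) ≤ c j * Real.exp s ^ j := by
  have hL : 0 < Real.log B := Real.log_pos hB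
  set t : Fin (d + 2) → ℝ := fun i => s₀ + (i : ℕ) * (2 * Real.log B) with ht
  have hmax : ∀ s : ℝ, ∃ j : Fin (d + 1), ∀ k ≤ d,
      c k * Real.exp s ^ k ≤ c j * Real.exp s ^ (j : ℕ) := by
    intro s
    obtain ⟨j, -, hj⟩ := Finset.exists_max_image (Finset.univ : Finset (Fin (d + 1)))
      (fun j => c j * Real.exp s ^ (j : ℕ)) Finset.univ_nonempty
    exact ⟨j, fun k hk => hj ⟨k, Nat.lt_succ_of_le hk⟩ (Finset.mem_univ _)⟩
  choose a ha using hmax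
  obtain ⟨i, i', hii, hai⟩ : ∃ i i', i < i' ∧ a (t i) = a (t i') := by
    obtain ⟨i, i', hne, h⟩ := Fintype.exists_ne_map_eq_of_card_lt (fun i => a (t i)) (by simp)
    rcases lt_or_gt_of_ne hne with h1 | h1
    · exact ⟨i, i', h1, h⟩
    · exact ⟨i', i, h1, h.symm⟩
  have h0i : s₀ ≤ t i := by simp only [ht]; nlinarith [Nat.cast_nonneg (α := ℝ) (i : ℕ)]
  have hi' : t i' ≤ s₀ + (d + 1) * (2 * Real.log B) := by
    have : ((i' : ℕ) : ℝ) ≤ d + 1 := by exact_mod_cast Nat.le_of_lt_succ i'.2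
    simp only [ht]
    nlinarith
  have hgap : t i + 2 * Real.log B ≤ t i' := by
    have : ((i : ℕ) : ℝ) + 1 ≤ (i' : ℕ) := by exact_mod_cast hii
    simp only [ht]
    nlinarith
  set j := a (t i) with hj
  have h1 := ha (t i)
  have h2 := ha (t i')
  rw [← hai] at h2
  rw [← hj] at h1
  -- shifting a comparison of two terms from `u` to `m` gains the factor `B`
  have shift : ∀ (u m : ℝ) (k : ℕ), c k * Real.exp u ^ k ≤ c j * Real.exp u ^ (j : ℕ) →
      Real.log B ≤ (m - u) * ((j : ℕ) - k) →
      B * (c k * Real.exp m ^ k) ≤ c j * Real.exp m ^ (j : ℕ) := by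
    intro u m k h hk
    simp only [← Real.exp_nat_mul] at h ⊢
    have hB' : Real.exp (Real.log B) = B := Real.exp_log (by linarith)
    calc B * (c k * Real.exp (k * m))
        = (c k * Real.exp (k * u)) * Real.exp (Real.log B + k * (m - u)) := by
          rw [Real.exp_add, hB', show (k : ℝ) * m = k * u + k * (m - u) by ring, Real.exp_add]
          ring
      _ ≤ (c j * Real.exp ((j : ℕ) * u)) * Real.exp ((j : ℕ) * (m - u)) := by
          refine mul_le_mul h (Real.exp_le_exp.2 (by nlinarith)) (Real.exp_pos _).le ?_
          exact mul_nonneg (hc _) (Real.exp_pos _).le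
      _ = _ := by
          rw [mul_assoc, ← Real.exp_add]
          congr 2
          ring
  refine ⟨(t i + t i') / 2, ⟨by linarith, by linarith⟩, j, Nat.le_of_lt_succ j.2,
    fun k hk hkj => ?_⟩
  rcases lt_or_gt_of_ne hkj with hlt | hlt
  · refine shift (t i) _ k (h1 k hk) ?_
    have : (k : ℝ) + 1 ≤ (j : ℕ) := by exact_mod_cast hlt
    nlinarith
  · refine shift (t i') _ k (h2 k hk) ?_
    have : ((j : ℕ) : ℝ) + 1 ≤ k := by exact_mod_cast hlt
    nlinarith

namespace Hyp3

/-- Where the zero weight does not dominate, the amoeba has points near any direction, at any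
distance up to a bounded error. -/
theorem exists_polar_mem_hypAmoeba (d : ℕ) (U : SU2) {N : Set SU2} (hN : N ∈ 𝓝 U) :
    ∃ K : ℝ, ∀ f : MvPolynomial (Fin 2 × Fin 2) ℂ, f.IsHomogeneous d → ∀ s₀ : ℝ,
      ¬ CentralDominance d f s₀ → ∃ s ∈ Set.Icc s₀ (s₀ + K), ∃ V ∈ N,
        polar V s ∈ hypAmoeba (zeroLocus f) := by
  obtain ⟨ε, hε, hgen⟩ := exists_pos_forall_mul_weightNorm_le d U hN
  set B : ℝ := (d + 1) / ε + 1 with hBdef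
  have hB : 1 < B := by
    have : 0 < ((d : ℝ) + 1) / ε := by positivity
    linarith
  have hdB : (d : ℝ) < ε * B := by
    rw [hBdef, mul_add, mul_div_cancel₀ _ hε.ne']
    linarith
  refine ⟨(d + 1) * (2 * Real.log B), fun f hf s₀ hs₀ => ?_⟩
  obtain ⟨V, hV, W, hVW⟩ := hgen f hf
  obtain ⟨s, hs, j, hj, hdom⟩ := exists_dominant_exponent d hB
    (c := fun j => weightNorm d j f) (fun j => weightNorm_nonneg d j f) s₀
  refine ⟨s, hs, V, hV, ?_⟩
  by_contra hnot
  have hep : ∀ k : ℕ, 0 < Real.exp s ^ k := fun k => pow_pos (Real.exp_pos s) k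
  rcases (weightNorm_nonneg d j f).eq_or_lt with h0 | hpos
  · -- all weight parts vanish
    apply hnot
    rw [polar_mem_hypAmoeba_iff_of_isHomogeneous hf]
    refine ⟨W, Finset.sum_eq_zero fun k hk => ?_⟩
    have hk := Nat.le_of_lt_succ (Finset.mem_range.1 hk)
    have hk0 : weightNorm d k f ≤ 0 := by
      rcases eq_or_ne k j with rfl | hkj
      · exact h0.symm.le
      · have h1 := hdom k hk hkj
        rw [← h0, zero_mul] at h1
        by_contra! hk0
        have := mul_pos (show 0 < B by linarith) (mul_pos hk0 (hep k))
        linarith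
    have h2 := (norm_coeff_fibrePoly_le V W hk hf).trans hk0
    rw [norm_le_zero_iff.1 h2, zero_mul]
  · have h2j : 2 * j = d := by
      refine two_mul_eq_of_dominant hf hnot W hj ?_
      have hA : 0 < weightNorm d j f * Real.exp s ^ j := mul_pos hpos (hep j)
      calc ∑ k ∈ (Finset.range (d + 1)).erase j,
            ‖(fibrePoly V.1 W.1 f).coeff k‖ * Real.exp s ^ k
          ≤ ∑ k ∈ (Finset.range (d + 1)).erase j, weightNorm d j f * Real.exp s ^ j / B := by
            refine Finset.sum_le_sum fun k hk => ?_
            rw [Finset.mem_erase, Finset.mem_range, Nat.lt_succ_iff] at hk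
            rw [le_div_iff₀ (by linarith), mul_comm]
            refine le_trans ?_ (hdom k hk.2 hk.1)
            refine mul_le_mul_of_nonneg_left ?_ (by linarith)
            exact mul_le_mul_of_nonneg_right (norm_coeff_fibrePoly_le V W hk.2 hf) (hep k).le
        _ = d * (weightNorm d j f * Real.exp s ^ j) / B := by
            rw [Finset.sum_const, Finset.card_erase_of_mem
              (Finset.mem_range.2 (Nat.lt_succ_of_le hj)), Finset.card_range, nsmul_eq_mul,
              show d.succ - 1 = d from rfl]
            ring
        _ < ε * (weightNorm d j f * Real.exp s ^ j) := by
            rw [div_lt_iff₀ (by linarith)]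
            nlinarith
        _ ≤ ‖(fibrePoly V.1 W.1 f).coeff j‖ * Real.exp s ^ j := by
            rw [← mul_assoc]
            exact mul_le_mul_of_nonneg_right (hVW j hj) (hep j).le
    refine hs₀ (CentralDominance.mono (r := s) ⟨j, h2j.symm, fun k hk hjk => ?_⟩ hs.1)
    have h1 := hdom k hk hjk.ne'
    have h2 : weightNorm d k f * Real.exp s ^ k ≤ weightNorm d j f * Real.exp s ^ j := by
      refine le_trans ?_ h1
      refine le_mul_of_one_le_left ?_ hB.le
      exact mul_nonneg (weightNorm_nonneg _ _ _) (hep k).le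
    rw [mul_sub, Real.exp_sub, mul_comm s, mul_comm s, Real.exp_nat_mul, Real.exp_nat_mul,
      ← mul_div_assoc, div_le_iff₀ (hep j)]
    exact h2

end Hyp3

/-! ### No amoeba points inside the ball -/

/-- Euler angles: `SU(2)` is generated by two conjugate maximal tori, in three steps. -/
theorem SU2.exists_eq_euler (A : SU2) : ∃ Q : SU2, ∃ u v w : ℂ, ‖u‖ = 1 ∧ ‖v‖ = 1 ∧ ‖w‖ = 1 ∧
    A = SU2.disc u * (Q * (SU2.disc v * (star Q * SU2.disc w))) := by
  obtain ⟨a, b, h, rfl⟩ := A.exists_eq_ofPair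
  have hI : ∀ t : ℝ, ‖Complex.exp (t * Complex.I)‖ = 1 := Complex.norm_exp_ofReal_mul_I
  have hv : ‖(‖a‖ : ℂ) + ‖b‖ * Complex.I‖ = 1 := by
    rw [Complex.norm_add_mul_I, h, Real.sqrt_one]
  set r : ℂ := (((√2)⁻¹ : ℝ) : ℂ) with hr
  have hrr : r * r = 1 / 2 := by
    rw [hr, ← Complex.ofReal_mul, ← mul_inv, Real.mul_self_sqrt (by norm_num)]
    norm_num
  have hrc : (starRingEnd ℂ) r = r := Complex.conj_ofReal _
  set Q : SU2 := SU2.ofPair r (r * Complex.I) (by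
    rw [norm_mul, Complex.norm_I, mul_one, hr, Complex.norm_real,
      Real.norm_of_nonneg (by positivity), inv_pow, Real.sq_sqrt (by norm_num)]
    norm_num) with hQ
  set u : ℂ := Complex.exp (((a.arg + b.arg) / 2 : ℝ) * Complex.I) with hu
  set w : ℂ := Complex.exp (((a.arg - b.arg) / 2 : ℝ) * Complex.I) with hw
  set v : ℂ := ‖a‖ + ‖b‖ * Complex.I with hv'
  have hvc : (starRingEnd ℂ) v = ‖a‖ - ‖b‖ * Complex.I := by
    simp [hv', sub_eq_add_neg]
  have hwc : w⁻¹ = Complex.exp (-((a.arg - b.arg) / 2 : ℝ) * Complex.I) := by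
    rw [hw, ← Complex.exp_neg, neg_mul]
  have ha : a = u * ‖a‖ * w := by
    rw [mul_right_comm, hu, hw, ← Complex.exp_add]
    conv_lhs => rw [← Complex.norm_mul_exp_arg_mul_I a]
    rw [mul_comm]
    congr 2
    push_cast
    ring
  have hb : b = u * ‖b‖ * (starRingEnd ℂ) w := by
    rw [← Complex.inv_eq_conj (hI _), mul_right_comm, hwc, hu, ← Complex.exp_add]
    conv_lhs => rw [← Complex.norm_mul_exp_arg_mul_I b]
    rw [mul_comm]
    congr 2
    push_cast
    ring
  have hdisc : ∀ z : ℂ, ‖z‖ = 1 → (SU2.disc z).1 = !![z, 0; 0, (starRingEnd ℂ) z] := by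
    intro z hz
    have hz0 : z ≠ 0 := by
      rintro rfl
      simp at hz
    rw [SU2.disc_of_norm_eq_one hz, ← Complex.inv_eq_conj hz]
    ext i j
    fin_cases i <;> fin_cases j <;> simp
    field_simp
  have hQs : (star Q).1 = !![r, -(r * Complex.I); -(r * Complex.I), r] := by
    change star Q.1 = _
    rw [hQ, SU2.coe_ofPair, Matrix.star_eq_conjTranspose]
    ext i j
    fin_cases i <;> fin_cases j <;> simp [hrc]
  have hmid : Q.1 * ((SU2.disc v).1 * (star Q).1) = !![(‖a‖ : ℂ), ‖b‖; -‖b‖, ‖a‖] := by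
    rw [hdisc v hv, hvc, hv', hQs, hQ, SU2.coe_ofPair]
    ext i j
    fin_cases i <;> fin_cases j <;> simp [hrc]
    · linear_combination (‖a‖ * (1 - Complex.I ^ 2) + ‖b‖ * Complex.I * (1 + Complex.I ^ 2) : ℂ) *
        hrr - (‖a‖ - ‖b‖ * Complex.I) / 2 * Complex.I_sq
    · linear_combination (- 2 * ‖b‖ * Complex.I ^ 2 : ℂ) * hrr - ‖b‖ * Complex.I_sq
    · linear_combination (2 * ‖b‖ * Complex.I ^ 2 : ℂ) * hrr + ‖b‖ * Complex.I_sq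
    · linear_combination (‖a‖ * (1 - Complex.I ^ 2) - ‖b‖ * Complex.I * (1 + Complex.I ^ 2) : ℂ) *
        hrr - (‖a‖ + ‖b‖ * Complex.I) / 2 * Complex.I_sq
  refine ⟨Q, u, v, w, hI _, hv, hI _, Subtype.ext ?_⟩
  calc (SU2.ofPair a b h).1
      = (SU2.disc u).1 * (!![(‖a‖ : ℂ), ‖b‖; -‖b‖, ‖a‖] * (SU2.disc w).1) := by
        rw [hdisc u (hI _), hdisc w (hI _), SU2.coe_ofPair]
        ext i j
        fin_cases i <;> fin_cases j <;> simp
        · rw [← mul_assoc, ← ha]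
        · rw [← mul_assoc, ← hb]
        · conv_lhs => rw [hb]
          simp
          ring
        · conv_lhs => rw [ha]
          simp
          ring
    _ = _ := by
        rw [← hmid]
        simp [Matrix.mul_assoc]

/-- A non-zero form does not vanish identically on `SL(2, ℂ)`. -/
theorem exists_eval_ne_zero_of_isHomogeneous {d : ℕ} {f : MvPolynomial (Fin 2 × Fin 2) ℂ}
    (hf : f.IsHomogeneous d) (h0 : f ≠ 0) :
    ∃ A : SL(2, ℂ), MvPolynomial.eval (fun ij => A.1 ij.1 ij.2) f ≠ 0 := by
  set D : MvPolynomial (Fin 2 × Fin 2) ℂ := MvPolynomial.X (0, 0) * MvPolynomial.X (1, 1) -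
    MvPolynomial.X (0, 1) * MvPolynomial.X (1, 0) with hD
  have hD0 : D ≠ 0 := by
    intro h
    have := congrArg (MvPolynomial.eval fun ij : Fin 2 × Fin 2 =>
      (1 : Matrix (Fin 2) (Fin 2) ℂ) ij.1 ij.2) h
    simp [hD] at this
  obtain ⟨x, hx⟩ : ∃ x, MvPolynomial.eval x (f * D) ≠ 0 := by
    by_contra! hcon
    exact mul_ne_zero h0 hD0 (MvPolynomial.funext fun x => by rw [hcon x, map_zero])
  rw [map_mul] at hx
  have hfx := left_ne_zero_of_mul hx
  have hDx := right_ne_zero_of_mul hx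
  set M : Matrix (Fin 2) (Fin 2) ℂ := Matrix.of fun i j => x (i, j) with hM
  have hdet : MvPolynomial.eval x D = M.det := by
    rw [Matrix.det_fin_two, hD]
    simp [hM]
  rw [hdet] at hDx
  obtain ⟨c, hc⟩ := IsAlgClosed.exists_pow_nat_eq M.det (n := 2) (by norm_num)
  have hc0 : c ≠ 0 := by
    rintro rfl
    exact hDx (by simpa using hc.symm)
  refine ⟨⟨c⁻¹ • M, by
    rw [Matrix.det_smul, Fintype.card_fin, ← hc, ← mul_pow, inv_mul_cancel₀ hc0, one_pow]⟩, ?_⟩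
  change MvPolynomial.eval (fun i => c⁻¹ * x i) f ≠ 0
  rw [← MvPolynomial.coe_aeval_eq_eval, RingHom.coe_coe, hf.aeval_mul,
    ← RingHom.coe_coe (MvPolynomial.aeval x), MvPolynomial.coe_aeval_eq_eval]
  exact mul_ne_zero (pow_ne_zero _ (inv_ne_zero hc0)) hfx

/-- If the zero weight dominates up to distance `r`, then all other weights are exponentially small
inside the ball of radius `r`. -/
theorem norm_coeff_fibrePoly_mul_exp_le {n : ℕ} {f : MvPolynomial (Fin 2 × Fin 2) ℂ}
    (hf : f.IsHomogeneous (2 * n)) {r : ℝ} (h : CentralDominance (2 * n) f r) {s : ℝ}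
    (hs : |s| ≤ r) (U W : SU2) {k : ℕ} (hk : k ≤ 2 * n) (hkn : k ≠ n) :
    ‖(fibrePoly U.1 W.1 f).coeff k‖ * Real.exp (s * ((k : ℝ) - n)) ≤
      Real.exp (-(r - |s|)) * weightNorm (2 * n) n f := by
  obtain ⟨n', hn', h⟩ := h
  obtain rfl : n = n' := by omega
  -- the statement for a positive weight, bounding any quantity `a` by the size of that weight part
  have main : ∀ (j : ℕ) (a t : ℝ), j ≤ 2 * n → n < j → 0 ≤ a → a ≤ weightNorm (2 * n) j f →
      t ≤ |s| → a * Real.exp (t * ((j : ℝ) - n)) ≤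
        Real.exp (-(r - |s|)) * weightNorm (2 * n) n f := by
    intro j a t hj hnj ha haj ht
    have hnj' : (n : ℝ) + 1 ≤ j := by exact_mod_cast hnj
    calc a * Real.exp (t * ((j : ℝ) - n))
        ≤ weightNorm (2 * n) j f *
          (Real.exp (-(r - |s|)) * Real.exp (r * ((j : ℝ) - n))) := by
          refine mul_le_mul haj ?_ (Real.exp_pos _).le (weightNorm_nonneg _ _ _)
          rw [← Real.exp_add]
          refine Real.exp_le_exp.2 ?_
          nlinarith
      _ = Real.exp (-(r - |s|)) *
          (weightNorm (2 * n) j f * Real.exp (r * ((j : ℝ) - n))) := by ring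
      _ ≤ _ := mul_le_mul_of_nonneg_left (h j hj hnj) (Real.exp_pos _).le
  rcases lt_or_gt_of_ne hkn with hlt | hlt
  · have h1 := norm_coeff_fibrePoly_sub_le U W (j := 2 * n - k) (by omega) hf
    rw [show 2 * n - (2 * n - k) = k by omega] at h1
    have h2 := main (2 * n - k) _ (-s) (by omega) (by omega) (norm_nonneg _) h1 (neg_le_abs s)
    rw [Nat.cast_sub hk] at h2
    convert! h2 using 3
    push_cast
    ring
  · exact main k _ s hk hlt (norm_nonneg _) (norm_coeff_fibrePoly_le U W hk hf) (le_abs_self s)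

theorem SU2.disc_one : SU2.disc 1 = 1 := by
  apply Subtype.ext
  rw [SU2.disc_of_norm_eq_one (by simp)]
  ext i j
  fin_cases i <;> fin_cases j <;> simp

/-- On each coset of the maximal torus the form is close to its zero weight coefficient. -/
theorem norm_eval_mul_disc_mul_sub_le {n : ℕ} {f : MvPolynomial (Fin 2 × Fin 2) ℂ}
    (hf : f.IsHomogeneous (2 * n)) {r : ℝ} (h : CentralDominance (2 * n) f r) (hr : 0 ≤ r)
    (U W : SU2) {z : ℂ} (hz : ‖z‖ = 1) :
    ‖MvPolynomial.eval (fun ij => (U * (SU2.disc z * W) : SU2).1 ij.1 ij.2) f -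
        (fibrePoly U.1 W.1 f).coeff n‖ ≤
      2 * n * (Real.exp (-r) * weightNorm (2 * n) n f) := by
  have hz0 : z ≠ 0 := by
    rintro rfl
    simp at hz
  have h1 := aeval_mul_disc_mul hf U.1 W.1 1 hz
  have h2 : Matrix.diagonal ![(1 : ℂ), 1] = 1 := by
    ext i j
    fin_cases i <;> fin_cases j <;> simp
  rw [h2, mul_one] at h1
  rw [← MvPolynomial.coe_aeval_eq_eval, RingHom.coe_coe]
  change ‖MvPolynomial.aeval (fun ij => (U.1 * ((SU2.disc z).1 * W.1)) ij.1 ij.2) f - _‖ ≤ _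
  have hn : n ∈ Finset.range (2 * n + 1) := Finset.mem_range.2 (by omega)
  rw [h1, ← Finset.add_sum_erase _ _ hn, mul_add, one_pow, mul_one]
  have h3 : z⁻¹ ^ (2 * n) * ((fibrePoly U.1 W.1 f).coeff n * z ^ (2 * n)) =
      (fibrePoly U.1 W.1 f).coeff n := by
    rw [mul_left_comm, ← mul_pow, inv_mul_cancel₀ hz0, one_pow, mul_one]
  rw [h3, add_sub_cancel_left, norm_mul, norm_pow, norm_inv, hz, inv_one, one_pow, one_mul]
  calc ‖∑ k ∈ (Finset.range (2 * n + 1)).erase n,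
        (fibrePoly U.1 W.1 f).coeff k * 1 ^ k * z ^ (2 * k)‖
      ≤ ∑ k ∈ (Finset.range (2 * n + 1)).erase n, Real.exp (-r) * weightNorm (2 * n) n f := by
        refine (norm_sum_le _ _).trans (Finset.sum_le_sum fun k hk => ?_)
        rw [Finset.mem_erase, Finset.mem_range, Nat.lt_succ_iff] at hk
        rw [one_pow, mul_one, norm_mul, norm_pow, hz, one_pow, mul_one]
        simpa using norm_coeff_fibrePoly_mul_exp_le hf h (s := 0) (by simpa using hr) U W hk.2 hk.1
    _ = _ := by
        rw [Finset.sum_const, Finset.card_erase_of_mem hn, Finset.card_range, nsmul_eq_mul,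
          Nat.add_sub_cancel]
        push_cast
        ring

/-- If the zero weight dominates, the form is nearly constant on `SU(2)`, because any two points are
joined by three arcs in cosets of maximal tori. -/
theorem norm_eval_sub_eval_le {n : ℕ} {f : MvPolynomial (Fin 2 × Fin 2) ℂ}
    (hf : f.IsHomogeneous (2 * n)) {r : ℝ} (h : CentralDominance (2 * n) f r) (hr : 0 ≤ r)
    (A B : SU2) :
    ‖MvPolynomial.eval (fun ij => A.1 ij.1 ij.2) f - MvPolynomial.eval (fun ij => B.1 ij.1 ij.2) f‖
      ≤ 6 * (2 * n * (Real.exp (-r) * weightNorm (2 * n) n f)) := by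
  set η := 2 * n * (Real.exp (-r) * weightNorm (2 * n) n f) with hη
  set F : SU2 → ℂ := fun A => MvPolynomial.eval (fun ij => A.1 ij.1 ij.2) f with hF
  have step : ∀ (U W : SU2) (z : ℂ), ‖z‖ = 1 → ‖F (U * (SU2.disc z * W)) - F (U * W)‖ ≤ 2 * η := by
    intro U W z hz
    have h1 := norm_eval_mul_disc_mul_sub_le hf h hr U W hz
    have h2 := norm_eval_mul_disc_mul_sub_le hf h hr U W (z := 1) (by simp)
    rw [SU2.disc_one, one_mul] at h2
    rw [two_mul]
    refine le_trans ?_ (add_le_add h1 h2)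
    rw [← dist_eq_norm, ← dist_eq_norm, ← dist_eq_norm]
    exact dist_triangle_right _ _ _
  obtain ⟨Q, u, v, w, hu, hv, hw, hA⟩ := (A * star B).exists_eq_euler
  have hBB : star B * B = 1 := by
    rw [Matrix.star_eq_inv, inv_mul_cancel]
  have hQQ : Q * star Q = 1 := by
    rw [Matrix.star_eq_inv, mul_inv_cancel]
  have hA' : A = 1 * (SU2.disc u * (Q * (SU2.disc v * (star Q * (1 * (SU2.disc w * B)))))) := by
    calc A = A * star B * B := by rw [mul_assoc, hBB, mul_one]
      _ = _ := by rw [hA]; simp only [one_mul, mul_assoc]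
  have h1 := step 1 (Q * (SU2.disc v * (star Q * (1 * (SU2.disc w * B))))) u hu
  rw [← hA', one_mul] at h1
  have h2 := step Q (star Q * (1 * (SU2.disc w * B))) v hv
  rw [← mul_assoc Q (star Q), hQQ, one_mul (1 * (SU2.disc w * B))] at h2
  have h3 := step 1 B w hw
  rw [one_mul B] at h3
  change ‖F A - F B‖ ≤ _
  have h4 := norm_add₃_le (a := F A - F (Q * (SU2.disc v * (star Q * (1 * (SU2.disc w * B))))))
    (b := F (Q * (SU2.disc v * (star Q * (1 * (SU2.disc w * B))))) - F (1 * (SU2.disc w * B)))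
    (c := F (1 * (SU2.disc w * B)) - F B)
  rw [sub_add_sub_cancel, sub_add_sub_cancel] at h4
  linarith

namespace Hyp3

/-- If the zero weight dominates up to distance `r`, then the amoeba misses the ball of radius `r`
up to a bounded error. -/
theorem lt_hdist_of_mem_hypAmoeba (d : ℕ) : ∃ K : ℝ, ∀ f : MvPolynomial (Fin 2 × Fin 2) ℂ,
    f.IsHomogeneous d → f ≠ 0 → ∀ r : ℝ, CentralDominance d f r →
      ∀ P ∈ hypAmoeba (zeroLocus f), r - K < hdist base P := by
  obtain ⟨ε, hε, hgen⟩ := exists_pos_forall_mul_weightNorm_le d 1 univ_mem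
  obtain ⟨K, hKε, hK⟩ : ∃ K : ℝ, 9 * (d * Real.exp (-K)) < ε ∧ 0 ≤ K := by
    have h1 : Tendsto (fun K : ℝ => 9 * (d * Real.exp (-K))) atTop (𝓝 (9 * (d * 0))) :=
      (Real.tendsto_exp_neg_atTop_nhds_zero.const_mul _).const_mul _
    rw [mul_zero, mul_zero] at h1
    exact ((h1.eventually (gt_mem_nhds hε)).and (eventually_ge_atTop 0)).exists
  refine ⟨K, fun f hf h0 r hdom P hP => ?_⟩
  obtain ⟨U, s, hs, rfl⟩ := exists_eq_polar P
  rw [hdist_base_polar, abs_of_nonneg hs]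
  by_contra! hsr
  obtain ⟨n, rfl, -⟩ := id hdom
  have hr : 0 ≤ r := by linarith
  have hexp : Real.exp (-r) ≤ Real.exp (-K) := Real.exp_le_exp.2 (by linarith)
  set c := weightNorm (2 * n) n f with hc
  have hc0 : 0 ≤ c := weightNorm_nonneg _ _ _
  have hnn : n ≤ 2 * n := by omega
  have hnr : n ∈ Finset.range (2 * n + 1) := Finset.mem_range.2 (by omega)
  have hcpos : 0 < c := by
    -- otherwise all weight parts vanish on `SU(2)`, hence the form vanishes by polar decomposition
    refine hc0.lt_of_ne fun h => ?_
    obtain ⟨A, hA⟩ := exists_eval_ne_zero_of_isHomogeneous hf h0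
    obtain ⟨U, s, -, hUs⟩ := exists_eq_polar (slAct A base)
    obtain ⟨W, rfl⟩ := (slAct_base_eq_polar_iff A U s).1 hUs
    apply hA
    have h1 := eval_mul_diagSL_mul hf U.1 W.1 s
    simp only [Matrix.SpecialLinearGroup.coe_mul, SU2.coe_toSL]
    rw [h1, Finset.sum_eq_zero, mul_zero]
    intro k hk
    have hk := Nat.le_of_lt_succ (Finset.mem_range.1 hk)
    rw [mul_eq_zero, ← norm_eq_zero]
    left
    refine le_antisymm ?_ (norm_nonneg _)
    rcases eq_or_ne k n with rfl | hkn
    · exact (norm_coeff_fibrePoly_le U W hk hf).trans h.symm.le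
    · have h2 := norm_coeff_fibrePoly_mul_exp_le hf hdom (s := 0) (by simpa using hr) U W hk hkn
      rw [← hc, ← h] at h2
      simpa using h2
  obtain ⟨V, -, W', hVW⟩ := hgen f hf
  obtain ⟨W, hW⟩ := (polar_mem_hypAmoeba_iff_of_isHomogeneous hf U s).1 hP
  set η := 2 * n * (Real.exp (-r) * c) with hη
  have hηK : η ≤ 2 * n * (Real.exp (-K) * c) :=
    mul_le_mul_of_nonneg_left (mul_le_mul_of_nonneg_right hexp hc0) (by positivity)
  have h1 := hVW n hnn
  have h2 := norm_eval_mul_disc_mul_sub_le hf hdom hr V W' (z := 1) (by simp)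
  have h3 := norm_eval_sub_eval_le hf hdom hr (U * (SU2.disc 1 * W)) (V * (SU2.disc 1 * W'))
  have h4 := norm_eval_mul_disc_mul_sub_le hf hdom hr U W (z := 1) (by simp)
  -- the zero weight coefficient is bounded below everywhere
  have hlow : ε * c ≤ ‖(fibrePoly U.1 W.1 f).coeff n‖ + 8 * η := by
    set a := (fibrePoly V.1 W'.1 f).coeff n
    set b := MvPolynomial.eval (fun ij => (V * (SU2.disc 1 * W') : SU2).1 ij.1 ij.2) f
    set b' := MvPolynomial.eval (fun ij => (U * (SU2.disc 1 * W) : SU2).1 ij.1 ij.2) f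
    set a' := (fibrePoly U.1 W.1 f).coeff n
    have e1 : ‖a‖ - ‖b‖ ≤ ‖b - a‖ := by
      rw [norm_sub_rev]
      exact norm_sub_norm_le _ _
    have e2 : ‖b‖ - ‖b'‖ ≤ ‖b' - b‖ := by
      rw [norm_sub_rev]
      exact norm_sub_norm_le _ _
    have e3 : ‖b'‖ - ‖a'‖ ≤ ‖b' - a'‖ := norm_sub_norm_le _ _
    linarith
  -- at a zero it is balanced by the other weights
  have hup : ‖(fibrePoly U.1 W.1 f).coeff n‖ ≤ 2 * n * (Real.exp (-K) * c) := by
    have hen : 0 < Real.exp s ^ n := pow_pos (Real.exp_pos s) n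
    rw [← Finset.add_sum_erase _ _ hnr, add_eq_zero_iff_eq_neg] at hW
    have h5 := congrArg norm hW
    rw [norm_neg, norm_mul, norm_pow, Complex.norm_real, Real.norm_of_nonneg (Real.exp_pos s).le]
      at h5
    refine le_of_mul_le_mul_right ?_ hen
    rw [h5]
    calc _ ≤ ∑ k ∈ (Finset.range (2 * n + 1)).erase n,
          Real.exp (-K) * c * Real.exp s ^ n := by
          refine (norm_sum_le _ _).trans (Finset.sum_le_sum fun k hk => ?_)
          rw [Finset.mem_erase, Finset.mem_range, Nat.lt_succ_iff] at hk
          rw [norm_mul, norm_pow, Complex.norm_real, Real.norm_of_nonneg (Real.exp_pos s).le]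
          have h6 := norm_coeff_fibrePoly_mul_exp_le hf hdom (s := s)
            (by rw [abs_of_nonneg hs]; linarith) U W hk.2 hk.1
          rw [mul_sub, Real.exp_sub, mul_comm s, mul_comm s, Real.exp_nat_mul, Real.exp_nat_mul,
            ← mul_div_assoc, div_le_iff₀ hen] at h6
          refine h6.trans ?_
          refine mul_le_mul_of_nonneg_right (mul_le_mul_of_nonneg_right ?_ hc0) hen.le
          rw [abs_of_nonneg hs]
          exact Real.exp_le_exp.2 (by linarith)
      _ = _ := by
          rw [Finset.sum_const, Finset.card_erase_of_mem hnr, Finset.card_range, nsmul_eq_mul,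
            Nat.add_sub_cancel]
          push_cast
          ring
  push_cast at hKε
  nlinarith

end Hyp3

/-! ### Tropical limits -/

theorem IsTropicalLimit.eq {ι : Type*} {l : Filter ι} [l.NeBot] {h : ι → ℝ} {X : ι → Set Hyp3}
    {L L' : Set Hyp3} (hL : IsTropicalLimit l h X L) (hL' : IsTropicalLimit l h X L') : L = L' :=
  Set.Subset.antisymm (fun P hP => hL'.1 P fun U hU => (hL.2 P hP U hU).frequently)
    fun P hP => hL.1 P fun U hU => (hL'.2 P hP U hU).frequently

theorem IsTropicalLimit.filter_mono {ι : Type*} {l l' : Filter ι} (hl : l' ≤ l) {h : ι → ℝ}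
    {X : ι → Set Hyp3} {L : Set Hyp3} (hL : IsTropicalLimit l h X L) : IsTropicalLimit l' h X L :=
  ⟨fun P hP => hL.1 P fun U hU => (hP U hU).filter_mono hl,
    fun P hP U hU => (hL.2 P hP U hU).filter_mono hl⟩

theorem IsSurfaceOf.exists_mem_hypAmoeba {d : ℕ} {f : MvPolynomial (Fin 2 × Fin 2) ℂ}
    {V : Set PSL(2, ℂ)} (h : IsSurfaceOf d f V) : ∃ P, P ∈ hypAmoeba (zeroLocus f) := by
  obtain ⟨-, -, rfl, g, hg⟩ := h
  exact ⟨_, g, hg, rfl⟩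

/-- If at almost every rescaled distance the dominance of the zero weight is eventually decided, and
fails at some distance, then the amoebas converge to the complement of a ball. -/
theorem exists_isTropicalLimit {ι : Type*} {l : Filter ι} [l.NeBot] {h : ι → ℝ}
    (hh : Tendsto h l atTop) {d : ℕ} {f : ι → MvPolynomial (Fin 2 × Fin 2) ℂ}
    {V : ι → Set PSL(2, ℂ)} (hV : ∀ᶠ i in l, IsSurfaceOf d (f i) (V i)) {D : Set ℝ} (hD : D.Finite)
    (hdec : ∀ ρ ∉ D, (∀ᶠ i in l, CentralDominance d (f i) (ρ * h i)) ∨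
      ∀ᶠ i in l, ¬ CentralDominance d (f i) (ρ * h i))
    (hex : ∃ ρ, ∀ᶠ i in l, ¬ CentralDominance d (f i) (ρ * h i)) :
    ∃ r : ℝ, 0 ≤ r ∧
      IsTropicalLimit l h (fun i => hypAmoeba (V i)) (Hyp3.openBall Hyp3.base r)ᶜ := by
  have hpos : ∀ᶠ i in l, 0 < h i := hh.eventually_gt_atTop 0
  set S : Set ℝ := insert 0 {ρ | ∀ᶠ i in l, CentralDominance d (f i) (ρ * h i)} with hS
  have hbdd : BddAbove S := by
    obtain ⟨ρ₀, hρ₀⟩ := hex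
    refine ⟨max 0 ρ₀, ?_⟩
    rintro ρ (rfl | hρ)
    · exact le_max_left _ _
    · refine le_trans ?_ (le_max_right _ _)
      by_contra! hlt
      obtain ⟨i, hi1, hi2, hi3⟩ := (hρ₀.and (hρ.and hpos)).exists
      exact hi1 (hi2.mono (mul_le_mul_of_nonneg_right hlt.le hi3.le))
  have h0S : (0 : ℝ) ∈ S := Set.mem_insert _ _
  set r := sSup S with hr
  have hr0 : 0 ≤ r := le_csSup hbdd h0S
  have hlt : ∀ ρ, 0 < ρ → ρ < r → ∀ᶠ i in l, CentralDominance d (f i) (ρ * h i) := by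
    intro ρ hρ0 hρ
    obtain ⟨ρ', hρ'S, hρρ'⟩ := exists_lt_of_lt_csSup ⟨0, h0S⟩ hρ
    rcases hρ'S with rfl | hρ'S
    · linarith
    · filter_upwards [hρ'S, hpos] with i hi1 hi2
      exact hi1.mono (mul_le_mul_of_nonneg_right hρρ'.le hi2.le)
  have hgt : ∀ ρ, r < ρ → ∀ᶠ i in l, ¬ CentralDominance d (f i) (ρ * h i) := by
    intro ρ hρ
    obtain ⟨ρ', ⟨hρ'1, hρ'2⟩, hρ'D⟩ := ((Set.Ioo_infinite hρ).sdiff hD).nonempty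
    rcases hdec ρ' hρ'D with h1 | h1
    · have := le_csSup hbdd (Set.mem_insert_of_mem 0 h1 : ρ' ∈ S)
      linarith
    · filter_upwards [h1, hpos] with i hi1 hi2 hi3
      exact hi1 (hi3.mono (mul_le_mul_of_nonneg_right hρ'2.le hi2.le))
  refine ⟨r, hr0, fun P hP => ?_, fun P hP M hM => ?_⟩
  · intro hPr
    have hPr : Hyp3.hdist Hyp3.base P < r := hPr
    have hP0 : 0 ≤ Hyp3.hdist Hyp3.base P := by
      obtain ⟨U, s, -, rfl⟩ := Hyp3.exists_eq_polar P
      rw [Hyp3.hdist_base_polar]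
      exact abs_nonneg s
    obtain ⟨ρ₁, hρ₁, hρ₁r⟩ := exists_between hPr
    obtain ⟨ρ₂, hρ₂, hρ₂r⟩ := exists_between hρ₁r
    obtain ⟨K, hK⟩ := Hyp3.lt_hdist_of_mem_hypAmoeba d
    have hU : {Q | Hyp3.hdist Hyp3.base Q < ρ₁} ∈ 𝓝 P :=
      Hyp3.continuous_hdist_base.continuousAt.eventually (gt_mem_nhds hρ₁)
    have hKh : ∀ᶠ i in l, K < (ρ₂ - ρ₁) * h i :=
      (hh.const_mul_atTop (by linarith)).eventually_gt_atTop K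
    obtain ⟨i, ⟨_, ⟨Q, hQ, rfl⟩, hQU⟩, hi1, hi2, hi3, hi4⟩ :=
      ((hP _ hU).and_eventually ((hlt ρ₂ (by linarith) hρ₂r).and (hpos.and (hKh.and hV)))).exists
    obtain ⟨hf0, hf, hVi, -⟩ := hi4
    have h1 := hK (f i) hf hf0 _ hi1 Q (hVi ▸ hQ)
    have h2 : Hyp3.hdist Hyp3.base (Hyp3.power (1 / h i) Q) < ρ₁ := hQU
    rw [Hyp3.hdist_base_power (by positivity), one_div, inv_mul_lt_iff₀ hi2] at h2
    linarith
  · have hPr : r ≤ Hyp3.hdist Hyp3.base P := not_lt.1 hP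
    obtain ⟨U, ρ, hρ0, rfl⟩ := Hyp3.exists_eq_polar P
    rw [Hyp3.hdist_base_polar, abs_of_nonneg hρ0] at hPr
    obtain ⟨N, hN, T, hT, hNT⟩ := mem_nhds_prod_iff.1
      (Hyp3.continuous_polar.continuousAt (x := (U, ρ)) hM)
    obtain ⟨δ, hδ, hδT⟩ := Metric.mem_nhds_iff.1 hT
    obtain ⟨K, hK⟩ := Hyp3.exists_polar_mem_hypAmoeba d U hN
    have hKh : ∀ᶠ i in l, K < δ / 3 * h i :=
      (hh.const_mul_atTop (by linarith)).eventually_gt_atTop K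
    filter_upwards [hgt (ρ + δ / 3) (by linarith), hpos, hKh, hV] with i hi1 hi2 hi3 hi4
    obtain ⟨-, hf, hVi, -⟩ := hi4
    obtain ⟨s, hs, W, hW, hmem⟩ := hK (f i) hf _ hi1
    suffices hT' : 1 / h i * s ∈ T by
      have hM' : Hyp3.polar W (1 / h i * s) ∈ M :=
        @hNT (W, 1 / h i * s) (Set.mk_mem_prod hW hT')
      rw [← Hyp3.power_polar] at hM'
      exact ⟨_, ⟨_, hVi ▸ hmem, rfl⟩, hM'⟩
    apply hδT
    rw [Metric.mem_ball, Real.dist_eq, one_div, inv_mul_eq_div, abs_sub_lt_iff, sub_lt_iff_lt_add,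
      div_lt_iff₀ hi2, sub_lt_comm, lt_div_iff₀ hi2]
    obtain ⟨hs1, hs2⟩ := hs
    have := mul_pos hδ hi2
    constructor <;> nlinarith

/-- The case of an arbitrary family: along an ultrafilter every dominance is decided. -/
theorem IsTropicalLimit.exists_eq_compl_openBall {ι : Type*} {l : Filter ι} [l.NeBot] {h : ι → ℝ}
    (hh : Tendsto h l atTop) {d : ℕ} {f : ι → MvPolynomial (Fin 2 × Fin 2) ℂ}
    {V : ι → Set PSL(2, ℂ)} {L : Set Hyp3} (hV : ∀ᶠ i in l, IsSurfaceOf d (f i) (V i))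
    (hL : IsTropicalLimit l h (fun i => hypAmoeba (V i)) L) (hne : L.Nonempty) :
    ∃ r : ℝ, 0 ≤ r ∧ L = (Hyp3.openBall Hyp3.base r)ᶜ := by
  have hu : (Ultrafilter.of l : Filter ι) ≤ l := Ultrafilter.of_le l
  obtain ⟨P, hP⟩ := hne
  obtain ⟨K, hK⟩ := Hyp3.lt_hdist_of_mem_hypAmoeba d
  set ρ := Hyp3.hdist Hyp3.base P with hρ
  have hnot : ∀ᶠ i in l, ¬ CentralDominance d (f i) ((ρ + 2) * h i) := by
    have hU : {Q | Hyp3.hdist Hyp3.base Q < ρ + 1} ∈ 𝓝 P :=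
      Hyp3.continuous_hdist_base.continuousAt.eventually (gt_mem_nhds (by linarith))
    filter_upwards [hL.2 P hP _ hU, hV, hh.eventually_gt_atTop 0, hh.eventually_gt_atTop K]
      with i ⟨_, ⟨Q, hQ, rfl⟩, hQU⟩ hi1 hi2 hi3 hdom
    obtain ⟨hf0, hf, hVi, -⟩ := hi1
    have h1 := hK (f i) hf hf0 _ hdom Q (hVi ▸ hQ)
    have h2 : Hyp3.hdist Hyp3.base (Hyp3.power (1 / h i) Q) < ρ + 1 := hQU
    rw [Hyp3.hdist_base_power (by positivity), one_div, inv_mul_lt_iff₀ hi2] at h2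
    linarith
  obtain ⟨r, hr, hlim⟩ := exists_isTropicalLimit (hh.mono_left hu) (hV.filter_mono hu)
    Set.finite_empty (fun ρ _ => by
      rw [Ultrafilter.eventually_not]
      exact em _) ⟨ρ + 2, hnot.filter_mono hu⟩
  exact ⟨r, hr, (hL.filter_mono hu).eq hlim⟩

/-! ### Growth of convergent real-power series -/

theorem seriesEval_zero (t : ℝ) : seriesEval 0 t = 0 := by simp [seriesEval]

/-- A convergent real-power series is asymptotic to its leading term. -/
theorem tendsto_seriesEval_mul_rpow {x : HahnSeries ℝ ℂ} (hx : SeriesConverges x) :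
    Tendsto (fun t : ℝ => seriesEval x t * ((t ^ x.order : ℝ) : ℂ)) atTop
      (𝓝 (x.coeff x.order)) := by
  obtain ⟨t₀, ht₀, ht₀1⟩ := (hx.and (eventually_ge_atTop 1)).exists
  have ht₀pos : 0 < t₀ := by linarith
  have hshift : ∀ t : ℝ, 0 < t → ∀ l : ℝ, x.coeff l * ((t ^ (-l) : ℝ) : ℂ) * ((t ^ x.order : ℝ) : ℂ)
      = x.coeff l * ((t ^ (-(l - x.order)) : ℝ) : ℂ) := by
    intro t ht l
    rw [mul_assoc, ← Complex.ofReal_mul, ← Real.rpow_add ht]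
    congr 3
    ring
  have hsum : ∑' l : ℝ, (if l = x.order then x.coeff x.order else 0) = x.coeff x.order :=
    tsum_ite_eq _ _
  rw [← hsum]
  have hmain : Tendsto (fun t : ℝ => ∑' l : ℝ, x.coeff l * ((t ^ (-(l - x.order)) : ℝ) : ℂ)) atTop
      (𝓝 (∑' l : ℝ, (if l = x.order then x.coeff x.order else 0))) := by
    refine tendsto_tsum_of_dominated_convergence
      (bound := fun l => ‖x.coeff l * ((t₀ ^ (-(l - x.order)) : ℝ) : ℂ)‖) ?_ ?_ ?_
    · refine Summable.norm ?_
      simp only [← hshift t₀ ht₀pos]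
      exact ht₀.mul_right _
    · intro l
      rcases lt_trichotomy l x.order with hl | rfl | hl
      · simp [HahnSeries.coeff_eq_zero_of_lt_order hl, hl.ne]
      · simp
      · rw [if_neg hl.ne']
        have h1 := tendsto_rpow_neg_atTop (sub_pos.2 hl)
        have h2 := ((Complex.continuous_ofReal.tendsto 0).comp h1).const_mul (x.coeff l)
        simpa using h2
    · filter_upwards [eventually_ge_atTop t₀] with t ht l
      rw [norm_mul, norm_mul, Complex.norm_real, Complex.norm_real,
        Real.norm_of_nonneg (Real.rpow_nonneg (by linarith) _),
        Real.norm_of_nonneg (Real.rpow_nonneg (by linarith) _)]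
      rcases lt_or_ge l x.order with hl | hl
      · simp [HahnSeries.coeff_eq_zero_of_lt_order hl]
      · refine mul_le_mul_of_nonneg_left ?_ (norm_nonneg _)
        exact Real.rpow_le_rpow_of_nonpos ht₀pos ht (by linarith)
  refine hmain.congr' ?_
  filter_upwards [eventually_gt_atTop 0] with t ht
  rw [seriesEval, ← tsum_mul_right]
  simp only [hshift t ht]

/-- The function `u` is eventually zero, or asymptotic to `a t ^ (-e)` with `a > 0`. -/
def HasPowerGrowth (u : ℝ → ℝ) : Prop :=
  (∀ᶠ t in atTop, u t = 0) ∨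
    ∃ e a : ℝ, 0 < a ∧ Tendsto (fun t : ℝ => u t * t ^ e) atTop (𝓝 a)

theorem HasPowerGrowth.add {u v : ℝ → ℝ} (hu : HasPowerGrowth u) (hv : HasPowerGrowth v) :
    HasPowerGrowth fun t => u t + v t := by
  -- the summand with the smaller exponent `e` dominates
  have dom : ∀ {u v : ℝ → ℝ} {e e' a b : ℝ}, 0 < a → 0 < b → e ≤ e' →
      Tendsto (fun t : ℝ => u t * t ^ e) atTop (𝓝 a) →
      Tendsto (fun t : ℝ => v t * t ^ e') atTop (𝓝 b) → HasPowerGrowth fun t => u t + v t := by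
    intro u v e e' a b ha hb hee hu hv
    rcases hee.eq_or_lt with rfl | hlt
    · refine .inr ⟨e, a + b, by linarith, ?_⟩
      simpa [add_mul] using hu.add hv
    · refine .inr ⟨e, a, ha, ?_⟩
      have h1 := hv.mul (tendsto_rpow_neg_atTop (sub_pos.2 hlt))
      have h2 : Tendsto (fun t : ℝ => v t * t ^ e) atTop (𝓝 (b * 0)) := by
        refine h1.congr' ?_
        filter_upwards [eventually_gt_atTop 0] with t ht
        rw [mul_assoc, ← Real.rpow_add ht]
        congr 2
        ring
      simpa [add_mul] using hu.add h2
  rcases hu with hu | ⟨e, a, ha, hu⟩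
  · rcases hv with hv | ⟨e', b, hb, hv⟩
    · left
      filter_upwards [hu, hv] with t h1 h2
      rw [h1, h2, add_zero]
    · refine .inr ⟨e', b, hb, hv.congr' ?_⟩
      filter_upwards [hu] with t h1
      rw [h1, zero_add]
  · rcases hv with hv | ⟨e', b, hb, hv⟩
    · refine .inr ⟨e, a, ha, hu.congr' ?_⟩
      filter_upwards [hv] with t h1
      rw [h1, add_zero]
    · rcases le_total e e' with h | h
      · exact dom ha hb h hu hv
      · simpa only [add_comm] using dom hb ha h hv hu

theorem HasPowerGrowth.sum {κ : Type*} (s : Finset κ) {u : κ → ℝ → ℝ}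
    (h : ∀ k ∈ s, HasPowerGrowth (u k)) : HasPowerGrowth fun t => ∑ k ∈ s, u k t := by
  classical
  induction s using Finset.induction_on with
  | empty => exact .inl (by simp)
  | insert k s hk ih =>
    simp only [Finset.sum_insert hk]
    exact (h k (Finset.mem_insert_self _ _)).add (ih fun j hj => h j (Finset.mem_insert_of_mem hj))

/-- Functions given near infinity by a convergent real-power series. -/
def IsSeriesSum (g : ℝ → ℂ) : Prop :=
  ∃ x : HahnSeries ℝ ℂ, SeriesConverges x ∧ ∀ᶠ t in atTop, g t = seriesEval x t

theorem IsSeriesSum.add {g g' : ℝ → ℂ} (hg : IsSeriesSum g) (hg' : IsSeriesSum g') :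
    IsSeriesSum fun t => g t + g' t := by
  obtain ⟨x, hx, hgx⟩ := hg
  obtain ⟨y, hy, hgy⟩ := hg'
  refine ⟨x + y, ?_, ?_⟩
  · filter_upwards [hx, hy] with t h1 h2
    simpa [add_mul] using h1.add h2
  · filter_upwards [hx, hy, hgx, hgy] with t h1 h2 h3 h4
    rw [h3, h4, seriesEval, seriesEval, seriesEval, ← h1.tsum_add h2]
    simp [add_mul]

theorem IsSeriesSum.mul_const {g : ℝ → ℂ} (hg : IsSeriesSum g) (c : ℂ) :
    IsSeriesSum fun t => g t * c := by
  obtain ⟨x, hx, hgx⟩ := hg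
  refine ⟨c • x, ?_, ?_⟩
  · filter_upwards [hx] with t h1
    simpa [mul_assoc] using h1.mul_left c
  · filter_upwards [hgx] with t h3
    rw [h3, seriesEval, seriesEval, ← tsum_mul_right]
    congr 1
    funext l
    simp
    ring

theorem IsSeriesSum.sum {κ : Type*} (s : Finset κ) {g : κ → ℝ → ℂ}
    (h : ∀ k ∈ s, IsSeriesSum (g k)) : IsSeriesSum fun t => ∑ k ∈ s, g k t := by
  classical
  induction s using Finset.induction_on with
  | empty =>
    refine ⟨0, ?_, ?_⟩
    · simp [SeriesConverges, summable_zero]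
    · simp [seriesEval_zero]
  | insert k s hk ih =>
    simp only [Finset.sum_insert hk]
    exact (h k (Finset.mem_insert_self _ _)).add (ih fun j hj => h j (Finset.mem_insert_of_mem hj))

theorem IsSeriesSum.hasPowerGrowth_norm {g : ℝ → ℂ} (hg : IsSeriesSum g) :
    HasPowerGrowth fun t => ‖g t‖ := by
  obtain ⟨x, hx, hgx⟩ := hg
  rcases eq_or_ne x 0 with rfl | h0
  · left
    filter_upwards [hgx] with t ht
    rw [ht, seriesEval_zero, norm_zero]
  · refine .inr ⟨x.order, ‖x.coeff x.order‖,
      norm_pos_iff.2 (HahnSeries.coeff_order_eq_zero.not.2 h0), ?_⟩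
    refine (tendsto_seriesEval_mul_rpow hx).norm.congr' ?_
    filter_upwards [hgx, eventually_ge_atTop 0] with t ht ht0
    rw [ht, norm_mul, Complex.norm_real, Real.norm_of_nonneg (Real.rpow_nonneg ht0 _)]

theorem hasPowerGrowth_weightNorm (d j : ℕ) {F : MvPolynomial (Fin 2 × Fin 2) (HahnSeries ℝ ℂ)}
    (hF : ∀ m, SeriesConverges (F.coeff m)) :
    HasPowerGrowth fun t => weightNorm d j (evalCoeffs F t) := by
  refine HasPowerGrowth.sum _ fun m _ => IsSeriesSum.hasPowerGrowth_norm ?_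
  have h : ∀ t, (weightCoeff j (evalCoeffs F t)).coeff m = ∑ k ∈ F.support,
      seriesEval (F.coeff k) t * (weightCoeff j (MvPolynomial.monomial k 1)).coeff m := by
    intro t
    rw [evalCoeffs, map_sum, MvPolynomial.coeff_sum]
    refine Finset.sum_congr rfl fun k _ => ?_
    conv_lhs => rw [← mul_one (seriesEval (F.coeff k) t), ← smul_eq_mul,
      ← MvPolynomial.smul_monomial, map_smul, MvPolynomial.coeff_smul, smul_eq_mul]
  simp only [h]
  exact IsSeriesSum.sum _ fun k _ => IsSeriesSum.mul_const ⟨_, hF k, .of_forall fun _ => rfl⟩ _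

/-- Comparison of two functions of power growth at a varying power scale. -/
theorem HasPowerGrowth.eventually_compare {u v : ℝ → ℝ} (hu : HasPowerGrowth u)
    (hv : HasPowerGrowth v) {k : ℝ} (hk : 0 < k) :
    (∀ᶠ t in atTop, u t = 0) ∨ ∃ ρ₀ : ℝ,
      (∀ ρ > ρ₀, ∀ᶠ t in atTop, v t < u t * Real.exp (ρ * Real.log t * k)) ∧
      ∀ ρ < ρ₀, (∀ᶠ t in atTop, u t * Real.exp (ρ * Real.log t * k) ≤ v t) ∨
        ∀ᶠ t in atTop, v t < u t * Real.exp (ρ * Real.log t * k) := by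
  have hexp : ∀ ρ : ℝ, ∀ t > 0, Real.exp (ρ * Real.log t * k) = t ^ (ρ * k) := by
    intro ρ t ht
    rw [Real.rpow_def_of_pos ht]
    congr 1
    ring
  rcases hu with hu | ⟨e, a, ha, hu⟩
  · exact .inl hu
  right
  rcases hv with hv | ⟨e', b, hb, hv⟩
  · have h1 : ∀ ρ : ℝ, ∀ᶠ t in atTop, v t < u t * Real.exp (ρ * Real.log t * k) := by
      intro ρ
      filter_upwards [hv, hu.eventually (lt_mem_nhds ha), eventually_gt_atTop 0] with t h1 h2 h3
      rw [h1]
      exact mul_pos (pos_of_mul_pos_left h2 (Real.rpow_nonneg h3.le _)) (Real.exp_pos _)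
    exact ⟨0, fun ρ _ => h1 ρ, fun ρ _ => .inr (h1 ρ)⟩
  · refine ⟨(e - e') / k, fun ρ hρ => ?_, fun ρ hρ => .inl ?_⟩
    · have hlt : 0 < ρ * k - e + e' := by
        rw [gt_iff_lt, div_lt_iff₀ hk] at hρ
        linarith
      have h1 := hv.mul (tendsto_rpow_neg_atTop hlt)
      rw [mul_zero] at h1
      obtain ⟨c, hc0, hca⟩ := exists_between ha
      filter_upwards [h1.eventually (gt_mem_nhds hc0), hu.eventually (lt_mem_nhds hca),
        eventually_gt_atTop 0] with t h2 h3 ht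
      have h4 := h2.trans h3
      rw [mul_assoc, ← Real.rpow_add ht] at h4
      rw [hexp ρ t ht]
      have h5 := mul_lt_mul_of_pos_right h4 (Real.rpow_pos_of_pos ht (ρ * k - e))
      rw [mul_assoc, mul_assoc, ← Real.rpow_add ht, ← Real.rpow_add ht] at h5
      convert! h5 using 1
      · rw [show e' + -(ρ * k - e + e') + (ρ * k - e) = 0 by ring, Real.rpow_zero, mul_one]
      · congr 2
        ring
    · have hlt : 0 < e - e' - ρ * k := by
        rw [lt_div_iff₀ hk] at hρ
        linarith
      have h1 := hu.mul (tendsto_rpow_neg_atTop hlt)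
      rw [mul_zero] at h1
      obtain ⟨c, hc0, hcb⟩ := exists_between hb
      filter_upwards [h1.eventually (gt_mem_nhds hc0), hv.eventually (lt_mem_nhds hcb),
        eventually_gt_atTop 0] with t h2 h3 ht
      have h4 := h2.trans h3
      rw [mul_assoc, ← Real.rpow_add ht] at h4
      rw [hexp ρ t ht]
      have h5 := mul_lt_mul_of_pos_right h4 (Real.rpow_pos_of_pos ht (-e'))
      rw [mul_assoc, mul_assoc, ← Real.rpow_add ht, ← Real.rpow_add ht] at h5
      refine le_of_lt ?_
      convert! h5 using 1
      · congr 2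
        ring
      · rw [add_neg_cancel, Real.rpow_zero, mul_one]

/-- The case of an algebraic family: dominance is decided by comparing leading exponents. -/
theorem IsSurfaceFamily.exists_isTropicalLimit {d : ℕ} {V : ℝ → Set PSL(2, ℂ)}
    (hV : IsSurfaceFamily d V) : ∃ r : ℝ, 0 ≤ r ∧
      IsTropicalLimit atTop Real.log (fun t => hypAmoeba (V t)) (Hyp3.openBall Hyp3.base r)ᶜ := by
  obtain ⟨F, -, hconv, hsurf⟩ := hV
  rcases Nat.even_or_odd' d with ⟨n, rfl | rfl⟩
  swap
  · -- in odd degree there is no zero weight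
    have hno : ∀ f r, ¬ CentralDominance (2 * n + 1) f r := by
      rintro f r ⟨m, hm, -⟩
      omega
    exact _root_.exists_isTropicalLimit Real.tendsto_log_atTop hsurf Set.finite_empty
      (fun ρ _ => .inr (.of_forall fun t => hno _ _)) ⟨0, .of_forall fun t => hno _ _⟩
  have hiff : ∀ f r, CentralDominance (2 * n) f r ↔ ∀ j ∈ Finset.Ioc n (2 * n),
      weightNorm (2 * n) j f * Real.exp (r * ((j : ℝ) - n)) ≤ weightNorm (2 * n) n f := by
    intro f r
    constructor
    · rintro ⟨m, hm, h⟩ j hj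
      obtain rfl : n = m := by omega
      rw [Finset.mem_Ioc] at hj
      exact h j hj.2 hj.1
    · exact fun h => ⟨n, rfl, fun j hj hnj => h j (Finset.mem_Ioc.2 ⟨hnj, hj⟩)⟩
  have hcmp := fun j (hj : j ∈ Finset.Ioc n (2 * n)) =>
    (hasPowerGrowth_weightNorm (2 * n) j hconv).eventually_compare
      (hasPowerGrowth_weightNorm (2 * n) n hconv) (k := (j : ℝ) - n)
      (sub_pos.2 (by exact_mod_cast (Finset.mem_Ioc.1 hj).1))
  have hcmp' : ∀ j, ∃ ρ₀ : ℝ, j ∈ Finset.Ioc n (2 * n) → ∀ ρ ≠ ρ₀,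
      (∀ᶠ t in atTop, weightNorm (2 * n) j (evalCoeffs F t) *
        Real.exp (ρ * Real.log t * ((j : ℝ) - n)) ≤ weightNorm (2 * n) n (evalCoeffs F t)) ∨
      ∀ᶠ t in atTop, weightNorm (2 * n) n (evalCoeffs F t) < weightNorm (2 * n) j (evalCoeffs F t) *
        Real.exp (ρ * Real.log t * ((j : ℝ) - n)) := by
    intro j
    by_cases hj : j ∈ Finset.Ioc n (2 * n)
    · rcases hcmp j hj with h | ⟨ρ₀, h1, h2⟩
      · refine ⟨0, fun _ ρ _ => .inl ?_⟩
        filter_upwards [h] with t ht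
        rw [ht, zero_mul]
        exact weightNorm_nonneg _ _ _
      · refine ⟨ρ₀, fun _ ρ hρ => ?_⟩
        rcases lt_or_gt_of_ne hρ with h | h
        · exact h2 ρ h
        · exact .inr (h1 ρ h)
    · exact ⟨0, fun h => absurd h hj⟩
  choose ρ₀ hρ₀ using hcmp'
  refine _root_.exists_isTropicalLimit Real.tendsto_log_atTop hsurf
    (D := ρ₀ '' (Finset.Ioc n (2 * n))) ((Finset.finite_toSet _).image _) (fun ρ hρ => ?_) ?_
  · simp only [hiff]
    by_cases hall : ∀ j ∈ Finset.Ioc n (2 * n), ∀ᶠ t in atTop,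
        weightNorm (2 * n) j (evalCoeffs F t) * Real.exp (ρ * Real.log t * ((j : ℝ) - n)) ≤
          weightNorm (2 * n) n (evalCoeffs F t)
    · exact .inl ((Finset.eventually_all _).2 hall)
    · simp only [not_forall, exists_prop] at hall
      obtain ⟨j, hj, hnot⟩ := hall
      refine .inr ?_
      rcases hρ₀ j hj ρ (fun h => hρ ⟨j, hj, h.symm⟩) with h | h
      · exact absurd h hnot
      · filter_upwards [h] with t ht hle
        exact absurd (hle j hj) (not_le.2 ht)
  · by_cases hall : ∀ j ∈ Finset.Ioc n (2 * n), ∀ᶠ t in atTop,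
        weightNorm (2 * n) j (evalCoeffs F t) = 0
    · -- all other weights vanish, so that the zero locus is empty
      exfalso
      obtain ⟨t, ht, hsurf⟩ := (((Finset.eventually_all _).2 hall).and hsurf).exists
      obtain ⟨K, hK⟩ := Hyp3.lt_hdist_of_mem_hypAmoeba (2 * n)
      obtain ⟨P, hP⟩ := hsurf.exists_mem_hypAmoeba
      obtain ⟨h0, hf, -, -⟩ := hsurf
      have h1 := hK _ hf h0 (Hyp3.hdist Hyp3.base P + K) ((hiff _ _).2 fun j hj => by
        rw [ht j hj, zero_mul]
        exact weightNorm_nonneg _ _ _) P hP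
      linarith
    · simp only [not_forall, exists_prop] at hall
      obtain ⟨j, hj, hnot⟩ := hall
      rcases hcmp j hj with h | ⟨ρ₁, h1, -⟩
      · exact absurd h hnot
      · refine ⟨ρ₁ + 1, ?_⟩
        filter_upwards [h1 (ρ₁ + 1) (by linarith)] with t ht hdom
        exact absurd ((hiff _ _).1 hdom j hj) (not_le.2 ht)

end

theorem claim1 :
    (∀ (d : ℕ) (V : ℝ → Set PSL(2, ℂ)), IsSurfaceFamily d V →
      ∃ r : ℝ, 0 ≤ r ∧
        IsTropicalLimit atTop Real.log (fun t => hypAmoeba (V t)) (Hyp3.openBall Hyp3.base r)ᶜ) ∧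
    (∀ (ι : Type*) (l : Filter ι) [l.NeBot] (h : ι → ℝ) (d : ℕ)
      (f : ι → MvPolynomial (Fin 2 × Fin 2) ℂ) (V : ι → Set PSL(2, ℂ)) (L : Set Hyp3),
      Tendsto h l atTop → (∀ᶠ i in l, IsSurfaceOf d (f i) (V i)) →
      IsTropicalLimit l h (fun i => hypAmoeba (V i)) L → L.Nonempty →
      ∃ r : ℝ, 0 ≤ r ∧ L = (Hyp3.openBall Hyp3.base r)ᶜ) :=
  ⟨fun _ _ hV => hV.exists_isTropicalLimit,
    fun _ _ _ _ _ _ _ _ hh hV hL hne => hL.exists_eq_compl_openBall hh hV hne⟩
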